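/- For a finite simple graph $G$ and $S\subseteq V(G)$, let $B(S)$ be the set of vertices outside $S$ that have at least one neighbour in $S$. Let $B(G;x,y)=\sum_{S\subseteq V(G)}x^{|B(S)|}y^{|S|}$ be the boundary polynomial of $G$, and let $B_{i,j}(G)$ be the number of sets $S\subseteq V(G)$ with $|B(S)|=i$ and $|S|=j$. For two such graphs $G_1,G_2$ without isolated vertices and $\alpha\in\mathbb{R}$, consider the planar system $$\dot x=\alpha x-y+B(G_1;x,y)-1,\qquad \dot y=x+\alpha y+B(G_2;x,y)-1, \tag{1}$$ and let its Liapunov number at the origin for $\alpha=0$ be $$\sigma_B=\tfrac{3\pi}{2}\bigl(3B_{0,3}(G_2)+B_{1,2}(G_1)+B_{2,1}(G_2)+2B_{0,2}(G_1)B_{0,2}(G_2)+B_{1,1}(G_1)B_{0,2}(G_1)-B_{1,1}(G_2)B_{0,2}(G_2)\bigr).$$ Let $K_n$ be the complete graph on $n$ vertices, $S_m$ the star on $m$ vertices (one centre joined to the $m-1$ others, with no further edges), $P_2$ the path on two vertices, $\sqcup$ the disjoint union, and $kP_2$ the disjoint union of $k$ copies of $P_2$. Let $G_1=K_n$ with $n\ge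 3$, and let either $G_2=S_m\sqcup P_2$ with $m=2$ or $m\ge 4$, or $G_2=S_m\sqcup kP_2$ with $m\ge 2$ and $k\ge 2$. Then $\sigma_B<0$, and a unique stable limit cycle of (1) bifurcates from the origin as $\alpha$ increases from zero. That is, there are a neighbourhood $U$ of the origin and $\alpha_0>0$ such that: - for $-\alpha_0<\alpha\le 0$, system (1) has no closed orbit (trace of a nonconstant periodic solution) contained in $U$; - for $0<\alpha<\alpha_0$, system (1) has exactly one closed orbit $\Gamma_\alpha$ contained in $U$, and $\Gamma_\alpha$ is a stable limit cycle: for every open set $V\supseteq\Gamma_\alpha$ there is an open set $W\supseteq\Gamma_\alpha$ such that every trajectory starting in $W$ exists for all $t\ge0$, stays in $V$ for all $t\ge 0$, and has $\Gamma_\alpha$ as its $\omega$-limit set; - $\Gamma_\alpha$ shrinks to the origin as $\alpha\to0^+$, i.e. every neighbourhood of the origin contains $\Gamma_\alpha$ for all sufficiently small $\alpha>0$. -/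

import Mathlib

open Set Filter Topology

namespace BoundaryHopf

section Graphs

open Classical in
/-- The boundary `B(S)` of a set of vertices `S`: the vertices outside `S` that have at least one
neighbour in `S`. -/
noncomputable def boundary {V : Type*} [Fintype V] (G : SimpleGraph V) (S : Finset V) :
    Finset V :=
  Finset.univ.filter (fun v => v ∉ S ∧ ∃ u ∈ S, G.Adj u v)

/-- The boundary polynomial `B(G; x, y) = ∑_{S ⊆ V(G)} x ^ |B(S)| * y ^ |S|`. -/
noncomputable def boundaryPoly {V : Type*} [Fintype V] (G : SimpleGraph V) (x y : ℝ) : ℝ :=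
  ∑ S : Finset V, x ^ (boundary G S).card * y ^ S.card

/-- The coefficient `B_{i,j}(G)`: the number of sets of vertices `S` with `|B(S)| = i` and
`|S| = j`. -/
noncomputable def boundaryCoeff {V : Type*} [Fintype V] (G : SimpleGraph V) (i j : ℕ) : ℕ :=
  (Finset.univ.filter (fun S : Finset V => (boundary G S).card = i ∧ S.card = j)).card

/-- The disjoint union of `k` copies of the graph `G`. -/
def copies {V : Type*} (k : ℕ) (G : SimpleGraph V) : SimpleGraph (Fin k × V) where
  Adj a b := a.1 = b.1 ∧ G.Adj a.2 b.2
  symm := ⟨fun _ _ h => ⟨h.1.symm, h.2.symm⟩⟩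
  loopless := ⟨fun _ h => G.irrefl h.2⟩

end Graphs

section Dynamics

/-- A closed orbit (cycle) of the autonomous planar vector field `X`: the trace of a nonconstant
periodic solution. -/
def IsClosedOrbit (X : ℝ × ℝ → ℝ × ℝ) (Γ : Set (ℝ × ℝ)) : Prop :=
  ∃ (γ : ℝ → ℝ × ℝ) (T : ℝ), 0 < T ∧ IsIntegralCurve γ (fun _ => X) ∧
    (∀ t, γ (t + T) = γ t) ∧ (∃ t, γ t ≠ γ 0) ∧ Γ = range γ

/-- The `ω`-limit set of a curve: all limits of `γ (t_n)` along sequences `t_n → +∞`. -/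
def omegaSet (γ : ℝ → ℝ × ℝ) : Set (ℝ × ℝ) :=
  {q | MapClusterPt q atTop γ}

/-- A stable limit cycle of `X`: a closed orbit `Γ` such that all trajectories that start close
enough to `Γ` exist for all positive times, stay in a prescribed neighbourhood of `Γ`, and have
`Γ` as their `ω`-limit set. -/
def IsStableLimitCycle (X : ℝ × ℝ → ℝ × ℝ) (Γ : Set (ℝ × ℝ)) : Prop :=
  IsClosedOrbit X Γ ∧
    ∀ V : Set (ℝ × ℝ), IsOpen V → Γ ⊆ V →
      ∃ W : Set (ℝ × ℝ), IsOpen W ∧ Γ ⊆ W ∧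
        ∀ p ∈ W, ∃ γ : ℝ → ℝ × ℝ, γ 0 = p ∧ IsIntegralCurveOn γ (fun _ => X) (Ici 0) ∧
          (∀ t, 0 ≤ t → γ t ∈ V) ∧ omegaSet γ = Γ

/-- In the one-parameter family `X α` of planar vector fields, a unique stable limit cycle
bifurcates from the origin as `α` increases from zero. There are a neighbourhood `U` of the origin
and `α₀ > 0` such that, for `-α₀ < α ≤ 0`, the set `U` contains no closed orbit, and, for
`0 < α < α₀`, it contains exactly one closed orbit `Γ α`, which is a stable limit cycle; and `Γ α`
shrinks to the origin as `α → 0⁺`. -/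
def UniqueStableLimitCycleBifurcates (X : ℝ → ℝ × ℝ → ℝ × ℝ) : Prop :=
  ∃ U ∈ 𝓝 (0 : ℝ × ℝ), ∃ α₀ : ℝ, 0 < α₀ ∧
    (∀ α, -α₀ < α → α ≤ 0 → ∀ Γ, IsClosedOrbit (X α) Γ → ¬ Γ ⊆ U) ∧
    ∃ Γ : ℝ → Set (ℝ × ℝ),
      (∀ α, 0 < α → α < α₀ →
        IsStableLimitCycle (X α) (Γ α) ∧ Γ α ⊆ U ∧
          ∀ Γ', IsClosedOrbit (X α) Γ' → Γ' ⊆ U → Γ' = Γ α) ∧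
      ∀ V ∈ 𝓝 (0 : ℝ × ℝ), ∀ᶠ α in 𝓝[>] (0 : ℝ), Γ α ⊆ V

end Dynamics

section System

variable {V₁ V₂ : Type*} [Fintype V₁] [Fintype V₂]

/-- The planar system
`dx/dt = α x - y + B(G₁; x, y) - 1`, `dy/dt = x + α y + B(G₂; x, y) - 1`. -/
noncomputable def hopfSystem (G₁ : SimpleGraph V₁) (G₂ : SimpleGraph V₂) (α : ℝ) :
    ℝ × ℝ → ℝ × ℝ :=
  fun p => (α * p.1 - p.2 + boundaryPoly G₁ p.1 p.2 - 1,
    p.1 + α * p.2 + boundaryPoly G₂ p.1 p.2 - 1)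

/-- The Liapunov number `σ_B` of the system at `α = 0`, in terms of the coefficients of the two
boundary polynomials. -/
noncomputable def sigmaB (G₁ : SimpleGraph V₁) (G₂ : SimpleGraph V₂) : ℝ :=
  3 * Real.pi / 2 *
    (3 * (boundaryCoeff G₂ 0 3 : ℝ) + (boundaryCoeff G₁ 1 2 : ℝ) + (boundaryCoeff G₂ 2 1 : ℝ)
      + 2 * (boundaryCoeff G₁ 0 2 : ℝ) * (boundaryCoeff G₂ 0 2 : ℝ)
      + (boundaryCoeff G₁ 1 1 : ℝ) * (boundaryCoeff G₁ 0 2 : ℝ)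
      - (boundaryCoeff G₂ 1 1 : ℝ) * (boundaryCoeff G₂ 0 2 : ℝ))

end System

end BoundaryHopf

/-! Write c = cos θ, s = sin θ, v = 1/r, and let q₂ be the quadratic part of the second equation on
the unit circle. Since `n ≥ 3`, the boundary polynomial of the complete graph has no quadratic part,
so θ' = 1 + O(r) and v' = -αv - s q₂ - r(cubic part) - O(r²). Put z = (v + a(θ))² + b(θ), where a is
a primitive of s q₂ and b is twice a primitive of the resulting cubic coefficient minus its mean.
Both are 2π-periodic, and z' = 2κ - 2α(v² + a v) + O(1/v), where -κ is that mean (`focalValue`). For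
these graphs σ_B = -12πκ. Up to small errors z' = 2κ - 2αz, an attracting linear equation exactly
when σ_B < 0 and α > 0.

For α ≤ 0, z increases along every orbit near the origin, so none of them closes up. For small α > 0
the field dz/dθ points into the strip κ/(2α) ≤ z ≤ 2κ/α and is strictly decreasing in z there
(`contractingStrip`). A fixed point of the return map gives a cycle (`exists_periodic`), and
exponential contraction (`antitoneOn_sq_dist_mul_exp`) gives its stability. A closed orbit near the
origin lies in the strip, because z' vanishes where z is extremal; contraction followed backwards in
time then makes it the same cycle (`closedOrbit_eq_loop`). As z is of order 1/α, the cycle shrinks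
to the origin.

What remains is the sign of σ_B. The complete graph contributes only B₁₂ ≤ 3, so it suffices that
3B₀₃ + B₂₁ + 3 < B₁₁B₀₂ for the second graph (`sigmaB_neg_and_bifurcates`). There leaves and
isolated edges make the right side large, while B₀₃ and B₂₁ are nonzero only if the star has three
vertices. -/

namespace BoundaryHopf

/-! ### Contracting periodic scalar equations: existence, periodic solution, exponential attraction.
-/

section ScalarODE

open scoped NNReal in
/-- A bounded, globally Lipschitz time-dependent vector field has global integral curves. -/
theorem exists_isIntegralCurve_of_lipschitzWith {E : Type*} [NormedAddCommGroup E]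
    [NormedSpace ℝ E] [CompleteSpace E] {f : ℝ → E → E} {K L : ℝ≥0}
    (hlip : ∀ t, LipschitzWith K (f t)) (hcont : ∀ x, Continuous fun t => f t x)
    (hb : ∀ t x, ‖f t x‖ ≤ L) (t₀ : ℝ) (x₀ : E) :
    ∃ γ : ℝ → E, γ t₀ = x₀ ∧ IsIntegralCurve γ f := by
  have hloc : ∀ n : ℕ, ∃ α : ℝ → E, α t₀ = x₀ ∧ ∀ t ∈ Ioo (t₀ - (n + 1)) (t₀ + (n + 1)),
      HasDerivAt α (f t (α t)) t := by
    intro n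
    have hn : (0 : ℝ) ≤ n := n.cast_nonneg
    have hmem : t₀ ∈ Icc (t₀ - (n + 1)) (t₀ + (n + 1)) := ⟨by linarith, by linarith⟩
    -- A curve of speed at most `L` travels at most `L * (n + 1)` in this time, so a ball of that
    -- radius meets the Picard–Lindelöf condition.
    have hpl : IsPicardLindelof f (⟨t₀, hmem⟩ : Icc (t₀ - (n + 1)) (t₀ + ((n : ℝ) + 1))) x₀
        (L * (n + 1)) 0 L K := by
      refine ⟨fun t _ => (hlip t).lipschitzOnWith, fun x _ => (hcont x).continuousOn,
        fun t _ x _ => hb t x, ?_⟩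
      simp
    obtain ⟨α, h0, hα⟩ := hpl.exists_eq_forall_mem_Icc_hasDerivWithinAt₀
    exact ⟨α, h0, fun t ht => (hα t (Ioo_subset_Icc_self ht)).hasDerivAt (Icc_mem_nhds ht.1 ht.2)⟩
  choose α hα0 hα using hloc
  have key : ∀ n m : ℕ, n ≤ m → EqOn (α n) (α m) (Ioo (t₀ - (n + 1)) (t₀ + (n + 1))) := by
    intro n m hnm
    have hn : (0 : ℝ) ≤ n := n.cast_nonneg
    have hnm' : (n : ℝ) ≤ m := by exact_mod_cast hnm
    refine ODE_solution_unique_of_mem_Ioo (v := f) (s := fun _ => univ) (K := K) (t₀ := t₀)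
      (fun t _ => (hlip t).lipschitzOnWith) ⟨by linarith, by linarith⟩
      (fun t ht => ⟨hα n t ht, trivial⟩)
      (fun t ht => ⟨hα m t ⟨by linarith [ht.1], by linarith [ht.2]⟩, trivial⟩) ?_
    rw [hα0, hα0]
  have hmem : ∀ t, t ∈ Ioo (t₀ - ((⌈|t - t₀|⌉₊ : ℝ) + 1)) (t₀ + ((⌈|t - t₀|⌉₊ : ℝ) + 1)) := by
    intro t
    have h1 := Nat.le_ceil |t - t₀|
    have h2 := le_abs_self (t - t₀)
    have h3 := neg_abs_le (t - t₀)
    constructor <;> linarith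
  -- The local solutions agree on overlaps, so each time may use the first interval known to contain
  -- it.
  refine ⟨fun t => α ⌈|t - t₀|⌉₊ t, by simp [hα0], fun t => ?_⟩
  have hev : (fun s => α ⌈|s - t₀|⌉₊ s) =ᶠ[𝓝 t] α ⌈|t - t₀|⌉₊ := by
    filter_upwards [Ioo_mem_nhds (hmem t).1 (hmem t).2] with s hs
    rcases le_total ⌈|s - t₀|⌉₊ ⌈|t - t₀|⌉₊ with h | h
    · exact key _ _ h (hmem s)
    · exact (key _ _ h hs).symm
  exact (hα _ t (hmem t)).congr_of_eventuallyEq hev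

/-- A `P`-periodic scalar field on the strip `z₁ ≤ z ≤ z₂` that points inwards on both boundary
lines and is uniformly strictly decreasing in `z`. -/
structure ContractingStrip (g : ℝ → ℝ → ℝ) (z₁ z₂ μ K P : ℝ) : Prop where
  lt : z₁ < z₂
  mu_pos : 0 < μ
  per_pos : 0 < P
  cont : ∀ z ∈ Icc z₁ z₂, Continuous fun θ => g θ z
  per : ∀ θ z, g (θ + P) z = g θ z
  lip : ∀ θ, ∀ z ∈ Icc z₁ z₂, ∀ z' ∈ Icc z₁ z₂, z ≤ z' → g θ z - g θ z' ≤ K * (z' - z)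
  contr : ∀ θ, ∀ z ∈ Icc z₁ z₂, ∀ z' ∈ Icc z₁ z₂, z ≤ z' → g θ z' - g θ z ≤ -μ * (z' - z)
  bot : ∀ θ, 0 < g θ z₁
  top : ∀ θ, g θ z₂ < 0

/-- The field extended from the strip to the plane so that it is constant above and below. -/
noncomputable def clampField (g : ℝ → ℝ → ℝ) {z₁ z₂ : ℝ} (h : z₁ ≤ z₂) (θ z : ℝ) : ℝ :=
  g θ (projIcc z₁ z₂ h z)

namespace ContractingStrip

variable {g : ℝ → ℝ → ℝ} {z₁ z₂ μ K P : ℝ}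

lemma clampField_of_mem (H : ContractingStrip g z₁ z₂ μ K P) {z : ℝ} (hz : z ∈ Icc z₁ z₂) (θ : ℝ) :
    clampField g H.lt.le θ z = g θ z := by
  simp [clampField, projIcc_of_mem H.lt.le hz]

lemma K_nonneg (H : ContractingStrip g z₁ z₂ μ K P) : 0 ≤ K := by
  have h1 := H.lip 0 z₁ (left_mem_Icc.2 H.lt.le) z₂ (right_mem_Icc.2 H.lt.le) H.lt.le
  have h2 := H.bot 0
  have h3 := H.top 0
  have h4 := H.lt
  by_contra hK
  nlinarith [mul_pos_of_neg_of_neg (not_le.1 hK) (sub_neg.2 h4)]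

lemma clampField_antitone (H : ContractingStrip g z₁ z₂ μ K P) (θ : ℝ) :
    Antitone (clampField g H.lt.le θ) := by
  intro x y hxy
  have hm := monotone_projIcc H.lt.le hxy
  have := H.contr θ _ (projIcc z₁ z₂ H.lt.le x).2 _ (projIcc z₁ z₂ H.lt.le y).2 hm
  have h2 : (0 : ℝ) ≤ (projIcc z₁ z₂ H.lt.le y : ℝ) - projIcc z₁ z₂ H.lt.le x := sub_nonneg.2 hm
  simp only [clampField]
  nlinarith [H.mu_pos]

lemma clampField_lipschitz (H : ContractingStrip g z₁ z₂ μ K P) (θ : ℝ) :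
    LipschitzWith K.toNNReal (clampField g H.lt.le θ) := by
  have key : ∀ x y, x ≤ y → |clampField g H.lt.le θ x - clampField g H.lt.le θ y| ≤ K * |x - y| := by
    intro x y hxy
    have hm := monotone_projIcc H.lt.le hxy
    have h1 := H.lip θ _ (projIcc z₁ z₂ H.lt.le x).2 _ (projIcc z₁ z₂ H.lt.le y).2 hm
    rw [abs_of_nonneg (sub_nonneg.2 (H.clampField_antitone θ hxy))]
    have h2 := (LipschitzWith.projIcc H.lt.le).dist_le_mul x y
    rw [Subtype.dist_eq, Real.dist_eq, Real.dist_eq, NNReal.coe_one, one_mul, abs_sub_comm] at h2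
    exact h1.trans (mul_le_mul_of_nonneg_left ((le_abs_self _).trans h2) H.K_nonneg)
  refine LipschitzWith.of_dist_le_mul fun x y => ?_
  rw [Real.dist_eq, Real.dist_eq, Real.coe_toNNReal _ H.K_nonneg]
  rcases le_total x y with h | h
  · exact key x y h
  · rw [abs_sub_comm, abs_sub_comm x]; exact key y x h

/-- By monotonicity all values lie between those at `z₂` and `z₁`, which have opposite signs and
differ by at most `K * (z₂ - z₁)`. -/
lemma clampField_bound (H : ContractingStrip g z₁ z₂ μ K P) (θ z : ℝ) :
    ‖clampField g H.lt.le θ z‖ ≤ (K * (z₂ - z₁)).toNNReal := by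
  rw [Real.coe_toNNReal _ (mul_nonneg H.K_nonneg (sub_nonneg.2 H.lt.le)), Real.norm_eq_abs, abs_le]
  have hl := left_mem_Icc.2 H.lt.le
  have hr := right_mem_Icc.2 H.lt.le
  have hp := (projIcc z₁ z₂ H.lt.le z).2
  have h1 := H.lip θ _ hl _ hr H.lt.le
  have h2 := H.contr θ _ hl _ hp hp.1
  have h3 := H.contr θ _ hp _ hr hp.2
  have h4 := H.bot θ
  have h5 := H.top θ
  have h6 := mul_nonneg H.mu_pos.le (sub_nonneg.2 hp.1)
  have h7 := mul_nonneg H.mu_pos.le (sub_nonneg.2 hp.2)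
  simp only [clampField]
  constructor <;> linarith

lemma exists_clamp_solution (H : ContractingStrip g z₁ z₂ μ K P) (θ₀ z₀ : ℝ) :
    ∃ Z : ℝ → ℝ, Z θ₀ = z₀ ∧ IsIntegralCurve Z (clampField g H.lt.le) :=
  exists_isIntegralCurve_of_lipschitzWith H.clampField_lipschitz
    (fun z => H.cont _ (projIcc z₁ z₂ H.lt.le z).2) H.clampField_bound θ₀ z₀

/-- The strip is forward invariant. -/
lemma clamp_solution_mem (H : ContractingStrip g z₁ z₂ μ K P) {Z : ℝ → ℝ}
    (hZ : IsIntegralCurve Z (clampField g H.lt.le)) {θ₀ θ : ℝ} (h0 : Z θ₀ ∈ Icc z₁ z₂)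
    (hθ : θ₀ ≤ θ) : Z θ ∈ Icc z₁ z₂ := by
  have hc : ContinuousOn Z (Icc θ₀ θ) := hZ.continuous.continuousOn
  have hl := left_mem_Icc.2 H.lt.le
  have hr := right_mem_Icc.2 H.lt.le
  constructor
  · have := image_le_of_deriv_right_lt_deriv_boundary' (f := fun x => -Z x)
      (B := fun _ => -z₁) (B' := fun _ => 0) (a := θ₀) (b := θ) hc.neg
      (fun x _ => (hZ x).neg.hasDerivWithinAt) (neg_le_neg h0.1) continuousOn_const
      (fun x _ => hasDerivWithinAt_const ..)
      (fun x _ hx => by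
        rw [neg_inj.1 hx, H.clampField_of_mem hl]; linarith [H.bot x])
      (right_mem_Icc.2 hθ)
    linarith
  · exact image_le_of_deriv_right_lt_deriv_boundary' (f := Z)
      (B := fun _ => z₂) (B' := fun _ => 0) (a := θ₀) (b := θ) hc
      (fun x _ => (hZ x).hasDerivWithinAt) h0.2 continuousOn_const
      (fun x _ => hasDerivWithinAt_const ..)
      (fun x _ hx => by
        rw [hx, H.clampField_of_mem hr]; linarith [H.top x])
      (right_mem_Icc.2 hθ)

/-- The extended field is nonincreasing in `z`, so the squared distance has nonpositive derivative.
This makes the return map continuous. -/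
lemma clamp_solution_dist_le (H : ContractingStrip g z₁ z₂ μ K P) {Y Z : ℝ → ℝ}
    (hY : IsIntegralCurve Y (clampField g H.lt.le)) (hZ : IsIntegralCurve Z (clampField g H.lt.le))
    {θ₀ θ : ℝ} (hθ : θ₀ ≤ θ) : |Y θ - Z θ| ≤ |Y θ₀ - Z θ₀| := by
  have hd : ∀ x, HasDerivAt (fun x => (Y x - Z x) ^ 2)
      (2 * (Y x - Z x) * (clampField g H.lt.le x (Y x) - clampField g H.lt.le x (Z x))) x := by
    intro x
    exact (((hY x).sub (hZ x)).pow 2).congr_deriv (by simp)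
  have hanti : Antitone fun x => (Y x - Z x) ^ 2 := by
    refine antitone_of_deriv_nonpos (fun x => (hd x).differentiableAt) fun x => ?_
    rw [(hd x).deriv]
    rcases le_total (Y x) (Z x) with h | h
    · have := H.clampField_antitone x h
      nlinarith
    · have := H.clampField_antitone x h
      nlinarith
  exact sq_le_sq.1 (hanti hθ)

/-- The field has a periodic solution inside the strip. -/
theorem exists_periodic (H : ContractingStrip g z₁ z₂ μ K P) :
    ∃ ζ : ℝ → ℝ, (∀ θ, HasDerivAt ζ (g θ (ζ θ)) θ) ∧ Function.Periodic ζ P ∧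
      ∀ θ, ζ θ ∈ Ioo z₁ z₂ := by
  choose Z hZ0 hZ using fun z => H.exists_clamp_solution 0 z
  have hcont : Continuous fun z => Z z P - z := by
    refine Continuous.sub (LipschitzWith.continuous (K := 1) ?_) continuous_id
    refine LipschitzWith.of_dist_le_mul fun x y => ?_
    have := H.clamp_solution_dist_le (hZ x) (hZ y) H.per_pos.le
    rw [hZ0, hZ0] at this
    simpa [Real.dist_eq] using this
  -- The return map sends the strip into itself, so its displacement is nonnegative at `z₁` and
  -- nonpositive at `z₂`.
  obtain ⟨z, hz, hfix⟩ : ∃ z ∈ Icc z₁ z₂, Z z P - z = 0 := by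
    have hl := left_mem_Icc.2 H.lt.le
    have hr := right_mem_Icc.2 H.lt.le
    have h1 := H.clamp_solution_mem (hZ z₁) (by rwa [hZ0]) H.per_pos.le
    have h2 := H.clamp_solution_mem (hZ z₂) (by rwa [hZ0]) H.per_pos.le
    exact intermediate_value_Icc' H.lt.le hcont.continuousOn
      ⟨by linarith [h2.2], by linarith [h1.1]⟩
  have hper : Function.Periodic (Z z) P := by
    have hshift : ∀ t, HasDerivAt (fun x => Z z (x + P)) (clampField g H.lt.le t (Z z (t + P))) t := by
      intro t
      have h1 := (hZ z (t + P)).comp_add_const t P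
      have h2 : clampField g H.lt.le (t + P) (Z z (t + P)) = clampField g H.lt.le t (Z z (t + P)) :=
        H.per _ _
      rwa [h2] at h1
    have := ODE_solution_unique_univ (v := clampField g H.lt.le) (s := fun _ => univ) (t₀ := 0)
      (fun t => (H.clampField_lipschitz t).lipschitzOnWith) (fun t => ⟨hshift t, trivial⟩)
      (fun t => ⟨hZ z t, trivial⟩) (by simp only [zero_add, hZ0]; linarith)
    exact fun x => congrFun this x
  -- Invariance holds only forwards; periodicity moves any `θ` into the period starting at `0`.
  have hmem : ∀ θ, Z z θ ∈ Icc z₁ z₂ := by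
    intro θ
    obtain ⟨y, hy, hy'⟩ := hper.exists_mem_Ico₀ H.per_pos θ
    rw [hy']
    exact H.clamp_solution_mem (hZ z) (by rwa [hZ0]) hy.1
  have hder : ∀ θ, HasDerivAt (Z z) (g θ (Z z θ)) θ := fun θ => by
    have := hZ z θ
    rwa [H.clampField_of_mem (hmem θ)] at this
  refine ⟨Z z, hder, hper, fun θ => ⟨lt_of_le_of_ne (hmem θ).1 fun h => ?_,
    lt_of_le_of_ne (hmem θ).2 fun h => ?_⟩⟩
  -- Touching an edge would be an extremum with zero derivative, against the strict inward
  -- direction.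
  · have hmin : IsLocalMin (Z z) θ := Eventually.of_forall fun x => h ▸ (hmem x).1
    have := hmin.hasDerivAt_eq_zero (hder θ)
    rw [← h] at this
    linarith [H.bot θ]
  · have hmax : IsLocalMax (Z z) θ := Eventually.of_forall fun x => h.symm ▸ (hmem x).2
    have := hmax.hasDerivAt_eq_zero (hder θ)
    rw [h] at this
    linarith [H.top θ]

/-- Solutions that start in the strip exist and stay there for all later times. -/
theorem exists_forward_solution (H : ContractingStrip g z₁ z₂ μ K P) (θ₀ : ℝ) {z₀ : ℝ}
    (hz₀ : z₀ ∈ Icc z₁ z₂) :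
    ∃ Z : ℝ → ℝ, Continuous Z ∧ Z θ₀ = z₀ ∧
      ∀ θ, θ₀ ≤ θ → Z θ ∈ Icc z₁ z₂ ∧ HasDerivAt Z (g θ (Z θ)) θ := by
  obtain ⟨Z, hZ0, hZ⟩ := H.exists_clamp_solution θ₀ z₀
  refine ⟨Z, hZ.continuous, hZ0, fun θ hθ => ?_⟩
  have hm := H.clamp_solution_mem hZ (by rwa [hZ0]) hθ
  refine ⟨hm, ?_⟩
  have := hZ θ
  rwa [H.clampField_of_mem hm] at this

/-- Along two curves in the strip that are driven by the field with speed at least `1 / 2`, the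
squared distance decays exponentially. -/
lemma antitoneOn_sq_dist_mul_exp (H : ContractingStrip g z₁ z₂ μ K P) {s : Set ℝ} (hs : Convex ℝ s)
    {θ θ' y z : ℝ → ℝ} (hθ : ∀ t ∈ s, 1 / 2 ≤ θ' t)
    (hym : ∀ t ∈ s, y t ∈ Icc z₁ z₂) (hzm : ∀ t ∈ s, z t ∈ Icc z₁ z₂)
    (hy : ∀ t ∈ s, HasDerivAt y (θ' t * g (θ t) (y t)) t)
    (hz : ∀ t ∈ s, HasDerivAt z (θ' t * g (θ t) (z t)) t) :
    AntitoneOn (fun t => (y t - z t) ^ 2 * Real.exp (μ * t)) s := by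
  have hd : ∀ t ∈ s, HasDerivAt (fun t => (y t - z t) ^ 2 * Real.exp (μ * t))
      ((2 * (y t - z t) * (θ' t * g (θ t) (y t) - θ' t * g (θ t) (z t)) + μ * (y t - z t) ^ 2)
        * Real.exp (μ * t)) t := by
    intro t ht
    have h1 : HasDerivAt (fun t => (y t - z t) ^ 2)
        (2 * (y t - z t) * (θ' t * g (θ t) (y t) - θ' t * g (θ t) (z t))) t := by
      exact (((hy t ht).sub (hz t ht)).pow 2).congr_deriv (by simp)
    have h2 : HasDerivAt (fun t => Real.exp (μ * t)) (Real.exp (μ * t) * μ) t := by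
      simpa using ((hasDerivAt_id t).const_mul μ).exp
    refine (h1.mul h2).congr_deriv ?_
    ring
  refine antitoneOn_of_deriv_nonpos hs (fun t ht => (hd t ht).continuousAt.continuousWithinAt)
    (fun t ht => (hd t (interior_subset ht)).differentiableAt.differentiableWithinAt) fun t ht => ?_
  have hts := interior_subset ht
  rw [(hd t hts).deriv]
  refine mul_nonpos_of_nonpos_of_nonneg ?_ (Real.exp_pos _).le
  have hθt := hθ t hts
  have hμ := H.mu_pos
  have key : (y t - z t) * (g (θ t) (y t) - g (θ t) (z t)) ≤ -μ * (y t - z t) ^ 2 := by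
    rcases le_total (y t) (z t) with h | h
    · have := H.contr (θ t) _ (hym t hts) _ (hzm t hts) h
      nlinarith [sub_nonneg.2 h]
    · have := H.contr (θ t) _ (hzm t hts) _ (hym t hts) h
      nlinarith [sub_nonneg.2 h]
  have h3 : θ' t * ((y t - z t) * (g (θ t) (y t) - g (θ t) (z t)))
      ≤ θ' t * (-μ * (y t - z t) ^ 2) := mul_le_mul_of_nonneg_left key (by linarith)
  have h4 : 0 ≤ μ * (y t - z t) ^ 2 := by positivity
  -- The squared distance decays at rate `2 * μ * θ'`, which is at least `μ` because `θ' ≥ 1 / 2`;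
  -- the exponential factor uses up exactly `μ`.
  nlinarith [mul_le_mul_of_nonneg_right hθt h4]

end ContractingStrip

end ScalarODE

/-! ### Time changes, polar lifts, ω-limit sets and functions of the angle. -/

section Angles

/-- A function with derivative at least `1 / 2` is onto and tends to infinity. -/
lemma surjective_of_half_le_deriv {f f' : ℝ → ℝ} (hd : ∀ x, HasDerivAt f (f' x) x)
    (hf' : ∀ x, 1 / 2 ≤ f' x) : Function.Surjective f ∧ Tendsto f atTop atTop := by
  have hc : Continuous f := continuous_iff_continuousAt.2 fun x => (hd x).continuousAt
  have hsub : Monotone fun x => f x - x / 2 := by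
    have hd2 : ∀ x, HasDerivAt (fun x => f x - x / 2) (f' x - 1 / 2) x := fun x =>
      (hd x).sub ((hasDerivAt_id x).div_const 2)
    refine monotone_of_deriv_nonneg (fun x => (hd2 x).differentiableAt) fun x => ?_
    rw [(hd2 x).deriv]
    linarith [hf' x]
  have htop : Tendsto f atTop atTop := by
    refine tendsto_atTop_mono' atTop (f₁ := fun x => x / 2 + f 0) ?_ ?_
    · filter_upwards [eventually_ge_atTop 0] with x hx
      have := hsub hx
      simp only at this
      linarith
    · exact tendsto_atTop_add_const_right _ _ (tendsto_id.atTop_div_const two_pos)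
  have hbot : Tendsto f atBot atBot := by
    refine tendsto_atBot_mono' atBot (f₁ := fun x => x / 2 + f 0) ?_ ?_
    · filter_upwards [eventually_le_atBot 0] with x hx
      have := hsub hx
      simp only at this
      linarith
    · exact tendsto_atBot_add_const_right _ _ (tendsto_id.atBot_div_const two_pos)
  exact ⟨hc.surjective htop hbot, htop⟩

/-- The autonomous scalar equation `dθ/dt = f θ` with bounded positive right-hand side has a global
solution that is an increasing bijection; if `f` is periodic, then `θ` advances by a period in a
fixed time. -/
theorem exists_timeChange {f : ℝ → ℝ} (hf : Continuous f) (hpos : ∀ x, 0 < f x)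
    (hle : ∀ x, f x ≤ 2) (θ₀ : ℝ) :
    ∃ θ : ℝ → ℝ, θ 0 = θ₀ ∧ (∀ t, HasDerivAt θ (f (θ t)) t) ∧ StrictMono θ ∧
      Function.Surjective θ ∧
      ∀ P, 0 < P → Function.Periodic f P → ∃ T, 0 < T ∧ ∀ t, θ (t + T) = θ t + P := by
  have hinv : Continuous fun x => (f x)⁻¹ := hf.inv₀ fun x => (hpos x).ne'
  -- Separation of variables: `τ φ` is the time at which angle `φ` is reached, and the solution is
  -- its inverse.
  set τ : ℝ → ℝ := fun φ => ∫ x in θ₀..φ, (f x)⁻¹ with hτ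
  have hd : ∀ φ, HasDerivAt τ (f φ)⁻¹ φ := fun φ =>
    (hinv.integral_hasStrictDerivAt θ₀ φ).hasDerivAt
  have hmono : StrictMono τ := strictMono_of_deriv_pos fun φ => by
    rw [(hd φ).deriv]; exact inv_pos.2 (hpos φ)
  have hτ0 : τ θ₀ = 0 := intervalIntegral.integral_same
  have hsurj : Function.Surjective τ := (surjective_of_half_le_deriv hd fun φ => by
    have := inv_anti₀ (hpos φ) (hle φ)
    linarith).1
  set e := hmono.orderIsoOfSurjective τ hsurj with he
  have hes : ∀ t, τ (e.symm t) = t := fun t => e.apply_symm_apply t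
  have hse : ∀ φ, e.symm (τ φ) = φ := fun φ => e.symm_apply_apply φ
  refine ⟨e.symm, ?_, fun t => ?_, e.symm.strictMono, e.symm.surjective, fun P hP hper => ?_⟩
  · rw [← hτ0, hse]
  · have := (hd (e.symm t)).of_local_left_inverse e.symm.toHomeomorph.continuous.continuousAt
      (inv_ne_zero (hpos _).ne') (Eventually.of_forall hes)
    rwa [inv_inv] at this
  · have hper' : Function.Periodic (fun x => (f x)⁻¹) P := fun x => by simp only [hper x]
    refine ⟨τ (θ₀ + P), hτ0 ▸ hmono (by linarith), fun t => ?_⟩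
    have h1 : τ (e.symm t + P) = t + τ (θ₀ + P) := by
      have h2 : τ (e.symm t + P) = τ (e.symm t) + ∫ x in (e.symm t)..(e.symm t + P), (f x)⁻¹ :=
        (intervalIntegral.integral_add_adjacent_intervals (hinv.intervalIntegrable _ _)
          (hinv.intervalIntegrable _ _)).symm
      rw [h2, hes, hper'.intervalIntegral_add_eq (e.symm t) θ₀]
    rw [← h1, hse]

/-- Polar coordinates along a curve that avoids the origin. -/
theorem exists_polar_lift {x y x' y' : ℝ → ℝ} (hx : ∀ t, HasDerivAt x (x' t) t)
    (hy : ∀ t, HasDerivAt y (y' t) t) (hx' : Continuous x') (hy' : Continuous y')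
    (hne : ∀ t, x t ^ 2 + y t ^ 2 ≠ 0) :
    ∃ ρ θ : ℝ → ℝ, (∀ t, x t = Real.exp (ρ t) * Real.cos (θ t)) ∧
      (∀ t, y t = Real.exp (ρ t) * Real.sin (θ t)) ∧
      (∀ t, HasDerivAt ρ ((x t * x' t + y t * y' t) / (x t ^ 2 + y t ^ 2)) t) ∧
      ∀ t, HasDerivAt θ ((x t * y' t - y t * x' t) / (x t ^ 2 + y t ^ 2)) t := by
  have hxc : Continuous x := continuous_iff_continuousAt.2 fun t => (hx t).continuousAt
  have hyc : Continuous y := continuous_iff_continuousAt.2 fun t => (hy t).continuousAt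
  set p : ℝ → ℝ := fun t => (x t * x' t + y t * y' t) / (x t ^ 2 + y t ^ 2) with hp
  set q : ℝ → ℝ := fun t => (x t * y' t - y t * x' t) / (x t ^ 2 + y t ^ 2) with hq
  have hpc : Continuous p := by fun_prop (disch := exact hne)
  have hqc : Continuous q := by fun_prop (disch := exact hne)
  set w₀ : ℂ := ⟨x 0, y 0⟩ with hw₀
  set ρ : ℝ → ℝ := fun t => Real.log ‖w₀‖ + ∫ s in (0 : ℝ)..t, p s with hρ
  set θ : ℝ → ℝ := fun t => Complex.arg w₀ + ∫ s in (0 : ℝ)..t, q s with hθ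
  have hdρ : ∀ t, HasDerivAt ρ (p t) t := fun t =>
    (hpc.integral_hasStrictDerivAt 0 t).hasDerivAt.const_add _
  have hdθ : ∀ t, HasDerivAt θ (q t) t := fun t =>
    (hqc.integral_hasStrictDerivAt 0 t).hasDerivAt.const_add _
  have hw₀ne : w₀ ≠ 0 := by
    intro h
    have h1 := congrArg Complex.re h
    have h2 := congrArg Complex.im h
    simp only [hw₀, Complex.zero_re, Complex.zero_im] at h1 h2
    exact hne 0 (by rw [h1, h2]; norm_num)
  have hexp : Real.exp (ρ 0) = ‖w₀‖ := by
    simp [hρ, Real.exp_log (norm_pos_iff.2 hw₀ne)]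
  have hθ0 : θ 0 = Complex.arg w₀ := by simp [hθ]
  -- With w = x + iy, the functions `p` and `q` are the real and imaginary parts of w'/w, and `A +
  -- iC` is w·exp(-ρ - iθ), whose derivative therefore vanishes.
  set A : ℝ → ℝ := fun t => Real.exp (-ρ t) * (x t * Real.cos (θ t) + y t * Real.sin (θ t)) with hA
  set C : ℝ → ℝ := fun t => Real.exp (-ρ t) * (y t * Real.cos (θ t) - x t * Real.sin (θ t)) with hC
  have hpx : ∀ t, x' t = x t * p t - y t * q t := by
    intro t
    have := hne t
    simp only [hp, hq]
    field_simp
    ring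
  have hqy : ∀ t, y' t = y t * p t + x t * q t := by
    intro t
    have := hne t
    simp only [hp, hq]
    field_simp
    ring
  have hdA : ∀ t, HasDerivAt A 0 t := by
    intro t
    refine ((hdρ t).neg.exp.mul (((hx t).mul (hdθ t).cos).add
      ((hy t).mul (hdθ t).sin))).congr_deriv ?_
    simp only [hpx, hqy, Pi.add_apply, Pi.mul_apply, Pi.neg_apply]
    ring
  have hdC : ∀ t, HasDerivAt C 0 t := by
    intro t
    refine ((hdρ t).neg.exp.mul (((hy t).mul (hdθ t).cos).sub
      ((hx t).mul (hdθ t).sin))).congr_deriv ?_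
    simp only [hpx, hqy, Pi.sub_apply, Pi.mul_apply, Pi.neg_apply]
    ring
  have hx0 : x 0 = ‖w₀‖ * Real.cos (θ 0) := by
    rw [hθ0, Complex.norm_mul_cos_arg]
  have hy0 : y 0 = ‖w₀‖ * Real.sin (θ 0) := by
    rw [hθ0, Complex.norm_mul_sin_arg]
  have hnn : ‖w₀‖ ≠ 0 := norm_ne_zero_iff.2 hw₀ne
  have hA1 : ∀ t, A t = 1 := by
    intro t
    have h := is_const_of_deriv_eq_zero (fun s => (hdA s).differentiableAt)
      (fun s => (hdA s).deriv) t 0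
    have h2 := Real.sin_sq_add_cos_sq (θ 0)
    rw [h]
    simp only [hA]
    rw [Real.exp_neg, hexp, hx0, hy0]
    field_simp
    linarith
  have hC0 : ∀ t, C t = 0 := by
    intro t
    have h := is_const_of_deriv_eq_zero (fun s => (hdC s).differentiableAt)
      (fun s => (hdC s).deriv) t 0
    rw [h]
    simp only [hC]
    rw [hx0, hy0]
    ring
  refine ⟨ρ, θ, fun t => ?_, fun t => ?_, hdρ, hdθ⟩
  · have h1 := hA1 t
    have h2 := hC0 t
    simp only [hA, hC] at h1 h2
    have h3 : x t * Real.cos (θ t) + y t * Real.sin (θ t) = Real.exp (ρ t) := by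
      rw [Real.exp_neg] at h1
      have := (Real.exp_pos (ρ t)).ne'
      field_simp at h1
      exact h1
    have h4 := (mul_eq_zero.1 h2).resolve_left (Real.exp_pos _).ne'
    have h5 := Real.sin_sq_add_cos_sq (θ t)
    rw [← h3]
    linear_combination (-x t) * h5 - Real.sin (θ t) * h4
  · have h1 := hA1 t
    have h2 := hC0 t
    simp only [hA, hC] at h1 h2
    have h3 : x t * Real.cos (θ t) + y t * Real.sin (θ t) = Real.exp (ρ t) := by
      rw [Real.exp_neg] at h1
      have := (Real.exp_pos (ρ t)).ne'
      field_simp at h1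
      exact h1
    have h4 := (mul_eq_zero.1 h2).resolve_left (Real.exp_pos _).ne'
    have h5 := Real.sin_sq_add_cos_sq (θ t)
    rw [← h3]
    linear_combination (-y t) * h5 + Real.cos (θ t) * h4

/-- A curve that approaches a continuous loop `G` while its phase tends to infinity has the loop as
its `ω`-limit set. -/
theorem omegaSet_eq_range {γ G : ℝ → ℝ × ℝ} {θ : ℝ → ℝ} {P : ℝ} (hP : 0 < P)
    (hG : Continuous G) (hper : Function.Periodic G P) (hθ : ContinuousOn θ (Ici 0))
    (hθt : Tendsto θ atTop atTop) (hd : Tendsto (fun t => dist (γ t) (G (θ t))) atTop (𝓝 0)) :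
    omegaSet γ = range G := by
  ext q
  constructor
  · intro hq
    have hcl : IsClosed (range G) := (hper.compact_of_continuous hP.ne' hG).isClosed
    rw [← hcl.closure_eq, Metric.mem_closure_iff]
    intro ε hε
    have h1 := mapClusterPt_iff_frequently.1 hq _ (Metric.ball_mem_nhds q (half_pos hε))
    have h2 : ∀ᶠ t in atTop, dist (γ t) (G (θ t)) < ε / 2 :=
      hd.eventually (gt_mem_nhds (half_pos hε))
    obtain ⟨t, ht1, ht2⟩ := (h1.and_eventually h2).exists
    refine ⟨G (θ t), mem_range_self _, ?_⟩
    have h3 := dist_triangle q (γ t) (G (θ t))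
    rw [Metric.mem_ball, dist_comm] at ht1
    linarith
  · rintro ⟨φ, rfl⟩
    -- The phase is continuous and unbounded above, so it passes through `φ` modulo `P` at
    -- arbitrarily late times.
    have hex : ∀ n : ℕ, ∃ t, (n : ℝ) ≤ t ∧ ∃ k : ℕ, θ t = φ + k * P := by
      intro n
      have hn : (0 : ℝ) ≤ n := n.cast_nonneg
      obtain ⟨k, hk⟩ := exists_nat_ge ((θ n - φ) / P)
      rw [div_le_iff₀ hP] at hk
      obtain ⟨s, hs1, hs2⟩ := ((hθt.eventually_ge_atTop (φ + k * P)).and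
        (eventually_ge_atTop (n : ℝ))).exists
      obtain ⟨t, ht, ht'⟩ := intermediate_value_Icc hs2
        (hθ.mono fun u hu => hn.trans hu.1) ⟨by linarith, hs1⟩
      exact ⟨t, ht.1, k, ht'⟩
    choose t ht k hk using hex
    have htt : Tendsto t atTop atTop :=
      tendsto_atTop_mono ht tendsto_natCast_atTop_atTop
    refine MapClusterPt.of_comp htt (Tendsto.mapClusterPt ?_)
    rw [tendsto_iff_dist_tendsto_zero]
    refine (hd.comp htt).congr fun n => ?_
    simp only [Function.comp_apply, hk]
    rw [hper.nat_mul]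

lemma periodic_eq_of_cos_sin_eq {h : ℝ → ℝ} (hper : Function.Periodic h (2 * Real.pi)) {x y : ℝ}
    (hc : Real.cos x = Real.cos y) (hs : Real.sin x = Real.sin y) : h x = h y := by
  obtain ⟨k, hk⟩ := Real.Angle.angle_eq_iff_two_pi_dvd_sub.1 (Real.Angle.cos_sin_inj hc hs)
  rw [show x = y + k * (2 * Real.pi) by linarith]
  exact hper.int_mul k y

/-- The argument jumps across the negative real axis, but a periodic function factors through
`Real.Angle`, where the argument is continuous away from the origin. -/
lemma continuousAt_periodic_comp_arg {h : ℝ → ℝ} (hh : Continuous h)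
    (hper : Function.Periodic h (2 * Real.pi)) {p : ℝ × ℝ} (hp : p ≠ 0) :
    ContinuousAt (fun p : ℝ × ℝ => h (Complex.arg ⟨p.1, p.2⟩)) p := by
  have hl : Continuous (hper.lift : Real.Angle → ℝ) := hh.quotient_liftOn' _
  have he : ContinuousAt (fun p : ℝ × ℝ => (⟨p.1, p.2⟩ : ℂ)) p :=
    Complex.equivRealProdCLM.symm.continuous.continuousAt
  have hne : (⟨p.1, p.2⟩ : ℂ) ≠ 0 := by
    intro h0
    exact hp (Prod.ext (congrArg Complex.re h0) (congrArg Complex.im h0))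
  exact hl.continuousAt.comp
    (ContinuousAt.comp (f := fun p : ℝ × ℝ => (⟨p.1, p.2⟩ : ℂ))
      (Complex.continuousAt_arg_coe_angle hne) he)

end Angles

/-! ### Estimates for the normal form in the variables θ, v = 1/r and z. -/

section PolarCoefficients

/-- Coefficients of a planar field in polar coordinates that is in third order normal form for the
radial variable `z = (1 / r + a θ) ^ 2 + b θ`: the angular speed is `1 + r * B r θ` and the speed of
`z` is `-2 * α * (1 / r ^ 2 + a θ / r) + 2 * κ + r * E r θ`. -/
structure PolarCoeffs (a b : ℝ → ℝ) (B E : ℝ → ℝ → ℝ) (κ M : ℝ) : Prop where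
  kappa_pos : 0 < κ
  one_le_M : 1 ≤ M
  a_cont : Continuous a
  b_cont : Continuous b
  a_per : Function.Periodic a (2 * Real.pi)
  b_per : Function.Periodic b (2 * Real.pi)
  B_cont : Continuous fun p : ℝ × ℝ => B p.1 p.2
  E_cont : Continuous fun p : ℝ × ℝ => E p.1 p.2
  B_per : ∀ r, Function.Periodic (B r) (2 * Real.pi)
  E_per : ∀ r, Function.Periodic (E r) (2 * Real.pi)
  a_le : ∀ θ, |a θ| ≤ M
  b_le : ∀ θ, |b θ| ≤ M
  B_le : ∀ r ∈ Icc (0 : ℝ) 1, ∀ θ, |B r θ| ≤ M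
  E_le : ∀ r ∈ Icc (0 : ℝ) 1, ∀ θ, |E r θ| ≤ M
  B_lip : ∀ r ∈ Icc (0 : ℝ) 1, ∀ r' ∈ Icc (0 : ℝ) 1, ∀ θ, |B r θ - B r' θ| ≤ M * |r - r'|
  E_lip : ∀ r ∈ Icc (0 : ℝ) 1, ∀ r' ∈ Icc (0 : ℝ) 1, ∀ θ, |E r θ - E r' θ| ≤ M * |r - r'|

/-- The normalised radial variable in terms of `v = 1 / r`. -/
def zOf (a b : ℝ → ℝ) (θ v : ℝ) : ℝ := (v + a θ) ^ 2 + b θ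

/-- The inverse radius in terms of the normalised radial variable. -/
noncomputable def vOf (a b : ℝ → ℝ) (θ z : ℝ) : ℝ := √(z - b θ) - a θ

/-- The angular speed at `r = 1 / v`. -/
noncomputable def angSpeed (B : ℝ → ℝ → ℝ) (θ v : ℝ) : ℝ := 1 + 1 / v * B (1 / v) θ

/-- The speed of the normalised radial variable at `r = 1 / v`. -/
noncomputable def radSpeed (a : ℝ → ℝ) (E : ℝ → ℝ → ℝ) (κ α θ v : ℝ) : ℝ :=
  -2 * α * (v ^ 2 + a θ * v) + 2 * κ + 1 / v * E (1 / v) θ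

/-- The field `dz/dθ`. -/
noncomputable def polarField (a b : ℝ → ℝ) (B E : ℝ → ℝ → ℝ) (κ α θ z : ℝ) : ℝ :=
  radSpeed a E κ α θ (vOf a b θ z) / angSpeed B θ (vOf a b θ z)

/-- A lower bound for the inverse radius beyond which the normal form dominates. -/
noncomputable def vMin (κ M : ℝ) : ℝ := 1000 * M * (1 + 1 / κ)

/-- The value of the normalised radial variable that guarantees inverse radius at least `V`. -/
def zMin (M V : ℝ) : ℝ := (V + M) ^ 2 + M

namespace PolarCoeffs

variable {a b : ℝ → ℝ} {B E : ℝ → ℝ → ℝ} {κ M : ℝ}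

lemma le_vMin (C : PolarCoeffs a b B E κ M) : 1000 * M ≤ vMin κ M := by
  have h1 := C.kappa_pos
  have h2 := C.one_le_M
  have h3 : 0 < 1 / κ := by positivity
  unfold vMin
  nlinarith

lemma le_kappa_mul_vMin (C : PolarCoeffs a b B E κ M) : 1000 * M ≤ κ * vMin κ M := by
  have h1 := C.kappa_pos
  have h2 := C.one_le_M
  have h3 : κ * vMin κ M = 1000 * M * κ + 1000 * M := by unfold vMin; field_simp
  rw [h3]
  nlinarith

lemma lt_vOf (C : PolarCoeffs a b B E κ M) {V z : ℝ} (hz : zMin M V < z) (θ : ℝ) :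
    V < vOf a b θ z := by
  have h1 := abs_le.1 (C.a_le θ)
  have h2 := abs_le.1 (C.b_le θ)
  have h3 : V + M < √(z - b θ) := by
    refine Real.lt_sqrt_of_sq_lt ?_
    unfold zMin at hz
    linarith [h2.2]
  unfold vOf
  linarith [h1.2]

lemma zOf_vOf (C : PolarCoeffs a b B E κ M) {V z : ℝ} (hz : zMin M V < z) (θ : ℝ) :
    zOf a b θ (vOf a b θ z) = z := by
  have h2 := abs_le.1 (C.b_le θ)
  have h3 : 0 ≤ z - b θ := by
    unfold zMin at hz
    nlinarith [sq_nonneg (V + M)]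
  unfold zOf vOf
  rw [sub_add_cancel, Real.sq_sqrt h3, sub_add_cancel]

lemma vOf_zOf (C : PolarCoeffs a b B E κ M) {v : ℝ} (hv : vMin κ M ≤ v) (θ : ℝ) :
    vOf a b θ (zOf a b θ v) = v := by
  have h1 := abs_le.1 (C.a_le θ)
  have h2 := C.le_vMin
  have h3 := C.one_le_M
  unfold vOf zOf
  rw [add_sub_cancel_right, Real.sqrt_sq (by linarith [h1.1]), add_sub_cancel_right]

section Bounds

variable {v : ℝ}

lemma inv_mem (C : PolarCoeffs a b B E κ M) (hv : vMin κ M ≤ v) :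
    0 < v ∧ 1 / v ∈ Icc (0 : ℝ) 1 := by
  have h2 := C.le_vMin
  have h3 := C.one_le_M
  have h4 : 1 ≤ v := by linarith
  have h5 : 0 < v := by linarith
  exact ⟨h5, by positivity, by rw [div_le_one h5]; exact h4⟩

lemma abs_inv_mul_B_le (C : PolarCoeffs a b B E κ M) (hv : vMin κ M ≤ v) (θ : ℝ) :
    |1 / v * B (1 / v) θ| ≤ 1 / 2 := by
  obtain ⟨h0, h1⟩ := C.inv_mem hv
  have h2 := C.le_vMin
  rw [abs_mul, abs_of_nonneg h1.1, div_mul_eq_mul_div, one_mul, div_le_iff₀ h0]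
  linarith [C.B_le _ h1 θ, C.one_le_M]

lemma abs_inv_mul_E_le (C : PolarCoeffs a b B E κ M) (hv : vMin κ M ≤ v) (θ : ℝ) :
    |1 / v * E (1 / v) θ| ≤ κ / 4 := by
  obtain ⟨h0, h1⟩ := C.inv_mem hv
  have h2 := C.le_kappa_mul_vMin
  have h3 := mul_le_mul_of_nonneg_left hv C.kappa_pos.le
  rw [abs_mul, abs_of_nonneg h1.1, div_mul_eq_mul_div, one_mul, div_le_iff₀ h0]
  linarith [C.E_le _ h1 θ, C.one_le_M]

lemma angSpeed_mem (C : PolarCoeffs a b B E κ M) (hv : vMin κ M ≤ v) (θ : ℝ) :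
    angSpeed B θ v ∈ Icc (1 / 2 : ℝ) (3 / 2) := by
  have := abs_le.1 (C.abs_inv_mul_B_le hv θ)
  unfold angSpeed
  constructor <;> linarith [this.1, this.2]

lemma abs_a_mul_le (C : PolarCoeffs a b B E κ M) (hv : vMin κ M ≤ v) (θ : ℝ) :
    |a θ * v| ≤ v ^ 2 / 1000 := by
  obtain ⟨h0, -⟩ := C.inv_mem hv
  have h2 := C.le_vMin
  rw [abs_mul, abs_of_pos h0]
  nlinarith [mul_le_mul_of_nonneg_right (C.a_le θ) h0.le]

/-- The corrections `2 * a * v`, `a ^ 2` and `b` are bounded by `2 * M * v`, `M ^ 2` and `M`, all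
negligible against `v ^ 2` once `v ≥ 1000 * M`. -/
lemma abs_zOf_sub_le (C : PolarCoeffs a b B E κ M) (hv : vMin κ M ≤ v) (θ : ℝ) :
    |zOf a b θ v - v ^ 2| ≤ v ^ 2 / 100 := by
  obtain ⟨h0, -⟩ := C.inv_mem hv
  have h2 := C.le_vMin
  have h3 := C.one_le_M
  have h4 := abs_le.1 (C.abs_a_mul_le hv θ)
  have h5 := abs_le.1 (C.b_le θ)
  have h6 : a θ ^ 2 ≤ M ^ 2 := sq_le_sq' (abs_le.1 (C.a_le θ)).1 (abs_le.1 (C.a_le θ)).2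
  have h7 : (1000 * M) ^ 2 ≤ v ^ 2 := pow_le_pow_left₀ (by linarith) (h2.trans hv) 2
  have h8 : M ≤ M ^ 2 := by nlinarith
  unfold zOf
  rw [abs_le]
  constructor <;> nlinarith [sq_nonneg (a θ)]

/-- For `α ≤ 0` the normalised radial variable increases. -/
lemma radSpeed_pos_of_nonpos (C : PolarCoeffs a b B E κ M) (hv : vMin κ M ≤ v) (θ : ℝ) {α : ℝ}
    (hα : α ≤ 0) : 0 < radSpeed a E κ α θ v := by
  have h1 := abs_le.1 (C.abs_a_mul_le hv θ)
  have h2 := abs_le.1 (C.abs_inv_mul_E_le hv θ)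
  have h3 := C.kappa_pos
  have h4 : 0 ≤ v ^ 2 + a θ * v := by nlinarith [sq_nonneg v]
  have h5 := mul_nonneg (neg_nonneg.2 hα) h4
  unfold radSpeed
  linarith [h2.1]

/-- The damping is at most 2·(11/10)·κ/2 and the remainder at most κ/4, less than the drift 2κ. -/
lemma radSpeed_pos (C : PolarCoeffs a b B E κ M) (hv : vMin κ M ≤ v) (θ : ℝ) {α : ℝ}
    (hα : 0 < α) (hz : α * zOf a b θ v ≤ κ / 2) : 0 < radSpeed a E κ α θ v := by
  have h1 := abs_le.1 (C.abs_a_mul_le hv θ)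
  have h2 := abs_le.1 (C.abs_inv_mul_E_le hv θ)
  have h3 := C.kappa_pos
  have h4 := abs_le.1 (C.abs_zOf_sub_le hv θ)
  have h5 : v ^ 2 + a θ * v ≤ 11 / 10 * zOf a b θ v := by nlinarith [sq_nonneg v]
  have h6 := mul_le_mul_of_nonneg_left h5 hα.le
  unfold radSpeed
  linarith [h2.1]

/-- The damping is at least 2·(9/10)·2κ, more than the drift 2κ plus the remainder κ/4. -/
lemma radSpeed_neg (C : PolarCoeffs a b B E κ M) (hv : vMin κ M ≤ v) (θ : ℝ) {α : ℝ}
    (hα : 0 < α) (hz : 2 * κ ≤ α * zOf a b θ v) : radSpeed a E κ α θ v < 0 := by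
  have h1 := abs_le.1 (C.abs_a_mul_le hv θ)
  have h2 := abs_le.1 (C.abs_inv_mul_E_le hv θ)
  have h3 := C.kappa_pos
  have h4 := abs_le.1 (C.abs_zOf_sub_le hv θ)
  have h5 : 9 / 10 * zOf a b θ v ≤ v ^ 2 + a θ * v := by nlinarith [sq_nonneg v]
  have h6 := mul_le_mul_of_nonneg_left h5 hα.le
  unfold radSpeed
  linarith [h2.2]

end Bounds

lemma abs_mul_sub_mul_le {F : ℝ → ℝ} {M r₁ r₂ : ℝ} (h2 : r₂ ∈ Icc (0 : ℝ) 1)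
    (h12 : r₂ ≤ r₁) (hF : |F r₁| ≤ M) (hl : |F r₁ - F r₂| ≤ M * |r₁ - r₂|) :
    |r₁ * F r₁ - r₂ * F r₂| ≤ 2 * M * (r₁ - r₂) := by
  rw [abs_of_nonneg (sub_nonneg.2 h12)] at hl
  have h : r₁ * F r₁ - r₂ * F r₂ = (r₁ - r₂) * F r₁ + r₂ * (F r₁ - F r₂) := by ring
  have h3 : |(r₁ - r₂) * F r₁| ≤ (r₁ - r₂) * M := by
    rw [abs_mul, abs_of_nonneg (sub_nonneg.2 h12)]
    exact mul_le_mul_of_nonneg_left hF (sub_nonneg.2 h12)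
  have h4 : |r₂ * (F r₁ - F r₂)| ≤ 1 * (M * (r₁ - r₂)) := by
    rw [abs_mul, abs_of_nonneg h2.1]
    exact mul_le_mul h2.2 hl (abs_nonneg _) zero_le_one
  rw [h]
  linarith [abs_add_le ((r₁ - r₂) * F r₁) (r₂ * (F r₁ - F r₂))]

/-- Two-sided slope bound for `dz/dθ` in the region where `α * z` is comparable to `κ`. -/
lemma speed_quotient_slope (C : PolarCoeffs a b B E κ M) {α v₁ v₂ : ℝ} (hα : 0 < α) (θ : ℝ)
    (hv₁ : vMin κ M ≤ v₁) (hv : v₁ ≤ v₂) (hz₁ : κ / 2 ≤ α * zOf a b θ v₁)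
    (hz₁' : α * zOf a b θ v₁ ≤ 2 * κ) :
    radSpeed a E κ α θ v₂ / angSpeed B θ v₂ - radSpeed a E κ α θ v₁ / angSpeed B θ v₁
        ≤ -α * (zOf a b θ v₂ - zOf a b θ v₁) ∧
      radSpeed a E κ α θ v₁ / angSpeed B θ v₁ - radSpeed a E κ α θ v₂ / angSpeed B θ v₂
        ≤ 5 * α * (zOf a b θ v₂ - zOf a b θ v₁) := by
  have hκ := C.kappa_pos
  have hM := C.one_le_M
  have hv₂ := hv₁.trans hv
  obtain ⟨p1, m1⟩ := C.inv_mem hv₁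
  obtain ⟨p2, m2⟩ := C.inv_mem hv₂
  have hT1 := C.angSpeed_mem hv₁ θ
  have hT2 := C.angSpeed_mem hv₂ θ
  have hV := C.le_vMin
  have hVκ := C.le_kappa_mul_vMin
  have ha := abs_le.1 (C.a_le θ)
  set δ := v₂ - v₁ with hδ
  set s := v₁ + v₂ with hs
  have hδ0 : 0 ≤ δ := sub_nonneg.2 hv
  -- closeness of the two radii
  have hzv := abs_le.1 (C.abs_zOf_sub_le hv₁ θ)
  have hav := abs_le.1 (C.abs_a_mul_le hv₁ θ)
  have h1 : 2 / 5 * κ ≤ α * v₁ ^ 2 := by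
    linarith [mul_le_mul_of_nonneg_left hzv.2 hα.le]
  have h1' : α * v₁ ^ 2 ≤ 21 / 10 * κ := by
    linarith [mul_le_mul_of_nonneg_left hzv.1 hα.le]
  have h2 : 2 / 5 * κ ≤ α * (v₁ * v₂) := by
    have : v₁ ^ 2 ≤ v₁ * v₂ := by nlinarith
    exact h1.trans (mul_le_mul_of_nonneg_left this hα.le)
  have hr : 1 / v₁ - 1 / v₂ = δ / (v₁ * v₂) := by
    rw [hδ]; field_simp
  have hr0 : 1 / v₂ ≤ 1 / v₁ := one_div_le_one_div_of_le p1 hv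
  -- Since `α * v₁ * v₂` is at least `2 / 5 * κ`, the radii differ by O(`α * δ`). The remainders are
  -- Lipschitz in the radius, so they change by O(`α * δ`), whereas the main term changes by `2 * α
  -- * δ * s` with `s` large.
  have hr1 : 1 / v₁ - 1 / v₂ ≤ 5 / 2 * (α * δ) / κ := by
    rw [hr, div_le_div_iff₀ (by positivity) hκ]
    linarith [mul_le_mul_of_nonneg_left h2 hδ0]
  have hBd := abs_mul_sub_mul_le (F := fun r => B r θ) m2 hr0 (C.B_le _ m1 θ)
    (C.B_lip _ m1 _ m2 θ)
  have hEd := abs_mul_sub_mul_le (F := fun r => E r θ) m2 hr0 (C.E_le _ m1 θ)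
    (C.E_lip _ m1 _ m2 θ)
  set e := 5 / 2 * (α * δ) / κ with he
  have he0 : 0 ≤ e := by positivity
  have heκ : κ * e = 5 / 2 * (α * δ) := by rw [he]; field_simp
  set T1 := angSpeed B θ v₁ with hT1d
  set T2 := angSpeed B θ v₂ with hT2d
  set N1 := radSpeed a E κ α θ v₁ with hN1d
  set N2 := radSpeed a E κ α θ v₂ with hN2d
  have hTd : |T1 - T2| ≤ 2 * M * e := by
    have : T1 - T2 = 1 / v₁ * B (1 / v₁) θ - 1 / v₂ * B (1 / v₂) θ := by
      simp only [hT1d, hT2d, angSpeed]; ring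
    rw [this]
    exact hBd.trans (mul_le_mul_of_nonneg_left hr1 (by linarith))
  have hNd : |(N2 - N1) - (-2 * (α * δ) * (s + a θ))| ≤ 2 * M * e := by
    have : (N2 - N1) - (-2 * (α * δ) * (s + a θ))
        = -(1 / v₁ * E (1 / v₁) θ - 1 / v₂ * E (1 / v₂) θ) := by
      simp only [hN1d, hN2d, radSpeed, hδ, hs]; ring
    rw [this, abs_neg]
    exact hEd.trans (mul_le_mul_of_nonneg_left hr1 (by linarith))
  have hN1 : |N1| ≤ 7 * κ := by
    have hE := abs_le.1 (C.abs_inv_mul_E_le hv₁ θ)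
    have h5 := mul_le_mul_of_nonneg_left hav.2 hα.le
    have h6 := mul_le_mul_of_nonneg_left hav.1 hα.le
    simp only [hN1d, radSpeed]
    rw [abs_le]
    constructor <;> linarith
  have hT1p : 0 < T1 := by linarith [hT1.1]
  have hT2p : 0 < T2 := by linarith [hT2.1]
  -- In this form the variation of the angular speed is multiplied by `N1 / T1`, which is bounded by
  -- `14 * κ`; the factor `κ` cancels the one in the denominator of `e`.
  have hq : N2 / T2 - N1 / T1 = ((N2 - N1) + N1 / T1 * (T1 - T2)) / T2 := by
    field_simp
    ring
  have hprod : |N1 / T1 * (T1 - T2)| ≤ 28 * M * (κ * e) := by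
    have h7 : |N1 / T1| ≤ 14 * κ := by
      rw [abs_div, abs_of_pos hT1p, div_le_iff₀ hT1p]
      nlinarith [hT1.1]
    rw [abs_mul]
    calc |N1 / T1| * |T1 - T2| ≤ (14 * κ) * (2 * M * e) :=
          mul_le_mul h7 hTd (abs_nonneg _) (by positivity)
      _ = 28 * M * (κ * e) := by ring
  rw [heκ] at hprod
  have hS : 2000 * M ≤ s := by rw [hs]; linarith
  have hSκ : 2000 * M ≤ κ * s := by
    have h8 := mul_le_mul_of_nonneg_left hv₁ hκ.le
    have h9 := mul_le_mul_of_nonneg_left hv₂ hκ.le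
    rw [hs]; linarith
  have hαδ : 0 ≤ α * δ := by positivity
  have hMe : 2 * M * e ≤ α * δ * s / 100 := by
    rw [he, mul_div_assoc', div_le_iff₀ hκ]
    linarith [mul_le_mul_of_nonneg_left hSκ hαδ, mul_nonneg hαδ (zero_le_one.trans hM)]
  have hMs : α * δ * M ≤ α * δ * s / 2000 := by
    linarith [mul_le_mul_of_nonneg_left hS hαδ]
  have ha1 := mul_le_mul_of_nonneg_left ha.1 hαδ
  have ha2 := mul_le_mul_of_nonneg_left ha.2 hαδ
  have hNd' := abs_le.1 hNd
  have hprod' := abs_le.1 hprod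
  have hαs : 0 ≤ α * δ * s := mul_nonneg hαδ (by linarith)
  -- All errors together stay below `α * δ * s / 5`. Dividing by `T2` between 1/2 and 3/2 leaves
  -- slopes between 1.2 and 4.4 times `α * δ * s`, which fit between `α` and `5 * α` times the
  -- change of `z`.
  have hnum1 : (N2 - N1) + N1 / T1 * (T1 - T2) ≤ -(18 / 10) * (α * δ * s) := by
    linarith [hNd'.2, hprod'.2]
  have hnum2 : -(22 / 10) * (α * δ * s) ≤ (N2 - N1) + N1 / T1 * (T1 - T2) := by
    linarith [hNd'.1, hprod'.1]
  have hzd : α * (zOf a b θ v₂ - zOf a b θ v₁) = α * δ * s + 2 * (α * δ * a θ) := by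
    simp only [zOf, hδ, hs]; ring
  set W := α * (zOf a b θ v₂ - zOf a b θ v₁) with hW
  have hzd1 : W ≤ 101 / 100 * (α * δ * s) := by linarith
  have hzd2 : 99 / 100 * (α * δ * s) ≤ W := by linarith
  have hW0 : 0 ≤ W := by linarith
  have hWT1 := mul_le_mul_of_nonneg_left hT2.1 hW0
  have hWT2 := mul_le_mul_of_nonneg_left hT2.2 hW0
  rw [neg_mul, mul_assoc 5 α, ← hW]
  constructor
  · rw [hq, div_le_iff₀ hT2p]
    linarith
  · rw [← neg_sub, hq, ← neg_div, div_le_iff₀ hT2p]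
    linarith

lemma continuous_vOf_comp (C : PolarCoeffs a b B E κ M) {θ z : ℝ → ℝ} (hθ : Continuous θ)
    (hz : Continuous z) : Continuous fun x => vOf a b (θ x) (z x) := by
  have h1 := C.a_cont
  have h2 := C.b_cont
  unfold vOf
  fun_prop

lemma continuous_angSpeed_comp (C : PolarCoeffs a b B E κ M) {θ v : ℝ → ℝ} (hθ : Continuous θ)
    (hv : Continuous v) (hne : ∀ x, v x ≠ 0) : Continuous fun x => angSpeed B (θ x) (v x) := by
  have h1 : Continuous fun x => 1 / v x := by fun_prop (disch := exact hne)
  have h2 : Continuous fun x => B (1 / v x) (θ x) := C.B_cont.comp (h1.prodMk hθ)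
  exact continuous_const.add (h1.mul h2)

lemma continuous_radSpeed_comp (C : PolarCoeffs a b B E κ M) {θ v : ℝ → ℝ} (α : ℝ)
    (hθ : Continuous θ) (hv : Continuous v) (hne : ∀ x, v x ≠ 0) :
    Continuous fun x => radSpeed a E κ α (θ x) (v x) := by
  have h0 := C.a_cont
  have h1 : Continuous fun x => 1 / v x := by fun_prop (disch := exact hne)
  have h2 : Continuous fun x => E (1 / v x) (θ x) := C.E_cont.comp (h1.prodMk hθ)
  have h3 : Continuous fun x => -2 * α * (v x ^ 2 + a (θ x) * v x) + 2 * κ := by fun_prop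
  exact h3.add (h1.mul h2)

lemma vOf_mem_of_strip (C : PolarCoeffs a b B E κ M) {α z : ℝ}
    (hmin : zMin M (vMin κ M) < κ / (2 * α)) (hz : κ / (2 * α) ≤ z) (θ : ℝ) :
    vMin κ M < vOf a b θ z ∧ zOf a b θ (vOf a b θ z) = z := by
  exact ⟨C.lt_vOf (hmin.trans_le hz) θ, C.zOf_vOf (hmin.trans_le hz) θ⟩

/-- For small `α > 0` the field `dz/dθ` is contracting on a strip. -/
theorem contractingStrip (C : PolarCoeffs a b B E κ M) {α : ℝ} (hα : 0 < α)
    (hmin : zMin M (vMin κ M) < κ / (2 * α)) :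
    ContractingStrip (polarField a b B E κ α) (κ / (2 * α)) (2 * κ / α) α (5 * α)
      (2 * Real.pi) := by
  have hκ := C.kappa_pos
  have hlt : κ / (2 * α) < 2 * κ / α := by
    rw [div_lt_div_iff₀ (by positivity) hα]
    nlinarith [mul_pos hκ hα]
  -- The edges of the strip are the two levels of `α * z` at which the sign of the radial speed is
  -- known.
  have e1 : α * (κ / (2 * α)) = κ / 2 := by field_simp
  have e2 : α * (2 * κ / α) = 2 * κ := by field_simp
  have hstrip : ∀ θ, ∀ z ∈ Icc (κ / (2 * α)) (2 * κ / α), ∀ z' ∈ Icc (κ / (2 * α)) (2 * κ / α),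
      z ≤ z' → polarField a b B E κ α θ z' - polarField a b B E κ α θ z ≤ -α * (z' - z) ∧
        polarField a b B E κ α θ z - polarField a b B E κ α θ z' ≤ 5 * α * (z' - z) := by
    intro θ z hz z' hz' hzz
    obtain ⟨m, k⟩ := C.vOf_mem_of_strip hmin hz.1 θ
    obtain ⟨m', k'⟩ := C.vOf_mem_of_strip hmin hz'.1 θ
    have hv : vOf a b θ z ≤ vOf a b θ z' := by
      unfold vOf
      gcongr
    have := C.speed_quotient_slope hα θ m.le hv
      (by rw [k, ← e1]; exact mul_le_mul_of_nonneg_left hz.1 hα.le)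
      (by rw [k, ← e2]; exact mul_le_mul_of_nonneg_left hz.2 hα.le)
    rw [k, k'] at this
    exact this
  refine ⟨hlt, hα, by positivity, fun z hz => ?_, fun θ z => ?_, fun θ z hz z' hz' h =>
    (hstrip θ z hz z' hz' h).2, fun θ z hz z' hz' h => (hstrip θ z hz z' hz' h).1, fun θ => ?_,
    fun θ => ?_⟩
  · have hm := fun θ => (C.vOf_mem_of_strip hmin hz.1 θ).1
    have hne : ∀ θ, vOf a b θ z ≠ 0 := fun θ => (C.inv_mem (hm θ).le).1.ne'
    have hc := C.continuous_vOf_comp continuous_id (continuous_const (y := z))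
    exact (C.continuous_radSpeed_comp α continuous_id hc hne).div
      (C.continuous_angSpeed_comp continuous_id hc hne)
      fun θ => by linarith [(C.angSpeed_mem (hm θ).le θ).1]
  · simp only [polarField, vOf, radSpeed, angSpeed, C.a_per θ, C.b_per θ, C.B_per _ θ, C.E_per _ θ]
  · obtain ⟨m, k⟩ := C.vOf_mem_of_strip hmin le_rfl θ
    exact div_pos (C.radSpeed_pos m.le θ hα (by rw [k, e1]))
      (by linarith [(C.angSpeed_mem m.le θ).1])
  · obtain ⟨m, k⟩ := C.vOf_mem_of_strip hmin hlt.le θ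
    exact div_neg_of_neg_of_pos (C.radSpeed_neg m.le θ hα (by rw [k, e2]))
      (by linarith [(C.angSpeed_mem m.le θ).1])

/-- The radius is a `1`-Lipschitz function of the normalised radial variable. -/
lemma abs_inv_vOf_sub_le (C : PolarCoeffs a b B E κ M) {V z z' : ℝ} (hV : vMin κ M ≤ V)
    (hz : zMin M V < z) (hz' : zMin M V < z') (θ : ℝ) :
    |1 / vOf a b θ z - 1 / vOf a b θ z'| ≤ |z - z'| := by
  have hM := C.one_le_M
  have hVm := C.le_vMin
  have ha := abs_le.1 (C.a_le θ)
  have h1 := C.lt_vOf hz θ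
  have h2 := C.lt_vOf hz' θ
  have k1 := C.zOf_vOf hz θ
  have k2 := C.zOf_vOf hz' θ
  set v := vOf a b θ z with hv
  set v' := vOf a b θ z' with hv'
  have p1 : 1 ≤ v := by linarith
  have p2 : 1 ≤ v' := by linarith
  have e1 : 1 / v - 1 / v' = (v' - v) / (v * v') := by field_simp
  have e2 : z - z' = (v - v') * (v + v' + 2 * a θ) := by
    rw [← k1, ← k2]; simp only [zOf]; ring
  rw [e1, e2, abs_div, abs_mul (v - v'), abs_sub_comm, abs_of_pos (show 0 < v * v' by positivity),
    abs_of_pos (show 0 < v + v' + 2 * a θ by linarith [ha.1])]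
  refine (div_le_self (abs_nonneg _) (by nlinarith)).trans ?_
  exact le_mul_of_one_le_right (abs_nonneg _) (by linarith [ha.1])

end PolarCoeffs

end PolarCoefficients

/-! ### From the contracting strip to the bifurcating planar limit cycle. -/

section PlanarBifurcation

/-- The point with polar coordinates `r` and `θ`. -/
noncomputable def polarPt (r θ : ℝ) : ℝ × ℝ := (r * Real.cos θ, r * Real.sin θ)

/-- The planar family `X` is in third order polar normal form with coefficients `a b B E κ`. -/
structure PolarNormalForm (X : ℝ → ℝ × ℝ → ℝ × ℝ) (a a' b b' : ℝ → ℝ) (B E : ℝ → ℝ → ℝ)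
    (κ M : ℝ) : Prop extends PolarCoeffs a b B E κ M where
  a_deriv : ∀ θ, HasDerivAt a (a' θ) θ
  b_deriv : ∀ θ, HasDerivAt b (b' θ) θ
  field_zero : ∀ α, X α 0 = 0
  field_cont : ∀ α, Continuous (X α)
  field_lip : ∀ α, ∃ K, LipschitzOnWith K (X α) (Metric.closedBall 0 1)
  angular : ∀ α θ v, 0 < v → Real.cos θ * (X α (polarPt (1 / v) θ)).2
    - Real.sin θ * (X α (polarPt (1 / v) θ)).1 = 1 / v * angSpeed B θ v
  radial : ∀ α θ v, 0 < v → 2 * (v + a θ) * (-(Real.cos θ * (X α (polarPt (1 / v) θ)).1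
      + Real.sin θ * (X α (polarPt (1 / v) θ)).2) * v ^ 2 + a' θ * angSpeed B θ v)
    + b' θ * angSpeed B θ v = radSpeed a E κ α θ v

lemma dist_polarPt_le (r r' θ : ℝ) : dist (polarPt r θ) (polarPt r' θ) ≤ |r - r'| := by
  rw [Prod.dist_eq, Real.dist_eq, Real.dist_eq]
  simp only [polarPt]
  rw [← sub_mul, ← sub_mul, abs_mul, abs_mul]
  exact max_le (mul_le_of_le_one_right (abs_nonneg _) (Real.abs_cos_le_one θ))
    (mul_le_of_le_one_right (abs_nonneg _) (Real.abs_sin_le_one θ))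

lemma polarPt_sq (r θ : ℝ) : (polarPt r θ).1 ^ 2 + (polarPt r θ).2 ^ 2 = r ^ 2 := by
  simp only [polarPt]
  linear_combination r ^ 2 * Real.sin_sq_add_cos_sq θ

lemma polarPt_ne_zero {r : ℝ} (hr : 0 < r) (θ : ℝ) : polarPt r θ ≠ 0 := by
  intro h
  have := polarPt_sq r θ
  rw [h] at this
  simp only [Prod.fst_zero, Prod.snd_zero] at this
  nlinarith

lemma polarPt_arg {r : ℝ} (hr : 0 < r) (θ : ℝ) :
    Real.cos (Complex.arg ⟨(polarPt r θ).1, (polarPt r θ).2⟩) = Real.cos θ ∧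
      Real.sin (Complex.arg ⟨(polarPt r θ).1, (polarPt r θ).2⟩) = Real.sin θ := by
  set w : ℂ := ⟨(polarPt r θ).1, (polarPt r θ).2⟩ with hw
  have hn : ‖w‖ = r := by
    rw [Complex.norm_eq_sqrt_sq_add_sq, hw, polarPt_sq, Real.sqrt_sq hr.le]
  have hw0 : w ≠ 0 := by
    rw [← norm_ne_zero_iff, hn]; exact hr.ne'
  rw [Complex.cos_arg hw0, Complex.sin_arg, hn, hw]
  simp only [polarPt]
  constructor <;> field_simp

lemma eq_polarPt_arg (p : ℝ × ℝ) :
    p = polarPt (√(p.1 ^ 2 + p.2 ^ 2)) (Complex.arg ⟨p.1, p.2⟩) := by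
  have h : √(p.1 ^ 2 + p.2 ^ 2) = ‖(⟨p.1, p.2⟩ : ℂ)‖ := by rw [Complex.norm_eq_sqrt_sq_add_sq]
  rw [h, polarPt, Complex.norm_mul_cos_arg, Complex.norm_mul_sin_arg]

/-- The closed loop `z = ζ θ`. -/
noncomputable def polarLoop (a b ζ : ℝ → ℝ) (θ : ℝ) : ℝ × ℝ := polarPt (1 / vOf a b θ (ζ θ)) θ

namespace PolarNormalForm

variable {X : ℝ → ℝ × ℝ → ℝ × ℝ} {a a' b b' : ℝ → ℝ} {B E : ℝ → ℝ → ℝ} {κ M α : ℝ}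

/-- Solutions in the variables `z, θ` give planar solutions. -/
lemma hasDerivAt_polarPt (H : PolarNormalForm X a a' b b' B E κ M) {z θ : ℝ → ℝ} {t : ℝ}
    (hz : zMin M (vMin κ M) < z t)
    (hdθ : HasDerivAt θ (angSpeed B (θ t) (vOf a b (θ t) (z t))) t)
    (hdz : HasDerivAt z (radSpeed a E κ α (θ t) (vOf a b (θ t) (z t))) t) :
    HasDerivAt (fun s => polarPt (1 / vOf a b (θ s) (z s)) (θ s))
      (X α (polarPt (1 / vOf a b (θ t) (z t)) (θ t))) t := by
  have C := H.toPolarCoeffs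
  have hv := C.lt_vOf hz (θ t)
  have hv0 := (C.inv_mem hv.le).1
  have ha := abs_le.1 (C.a_le (θ t))
  have hq : √(z t - b (θ t)) = vOf a b (θ t) (z t) + a (θ t) := by unfold vOf; ring
  have hang := H.angular α (θ t) _ hv0
  have hrad := H.radial α (θ t) _ hv0
  have hle := C.le_vMin
  have hM := C.one_le_M
  set v := vOf a b (θ t) (z t) with hvd
  set ω := angSpeed B (θ t) v with hω
  set x₁ := (X α (polarPt (1 / v) (θ t))).1 with hx₁
  set x₂ := (X α (polarPt (1 / v) (θ t))).2 with hx₂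
  have hva : 0 < v + a (θ t) := by linarith [ha.1]
  -- The identity `radial` is z' = 2(v + a)(v' + a'θ') + b'θ' with v' = -r'v²; here it is solved for
  -- v'.
  have hdv : HasDerivAt (fun s => vOf a b (θ s) (z s))
      (-(Real.cos (θ t) * x₁ + Real.sin (θ t) * x₂) * v ^ 2) t := by
    have hne : z t - b (θ t) ≠ 0 := by
      intro h0
      rw [h0, Real.sqrt_zero] at hq
      linarith
    have h1 : HasDerivAt (fun s => √(z s - b (θ s)) - a (θ s))
        ((radSpeed a E κ α (θ t) v - b' (θ t) * ω) / (2 * √(z t - b (θ t))) - a' (θ t) * ω) t :=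
      ((hdz.sub ((H.b_deriv (θ t)).comp t hdθ)).sqrt hne).sub ((H.a_deriv (θ t)).comp t hdθ)
    refine h1.congr_deriv ?_
    rw [hq, ← hrad]
    field_simp
    ring
  have hdr : HasDerivAt (fun s => 1 / vOf a b (θ s) (z s))
      (Real.cos (θ t) * x₁ + Real.sin (θ t) * x₂) t := by
    simp only [one_div]
    refine (hdv.inv hv0.ne').congr_deriv ?_
    rw [← hvd]
    field_simp
  have hsc := Real.sin_sq_add_cos_sq (θ t)
  have hd1 : HasDerivAt (fun s => 1 / vOf a b (θ s) (z s) * Real.cos (θ s)) x₁ t := by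
    refine (hdr.mul hdθ.cos).congr_deriv ?_
    rw [← hvd]
    linear_combination x₁ * hsc + Real.sin (θ t) * hang
  have hd2 : HasDerivAt (fun s => 1 / vOf a b (θ s) (z s) * Real.sin (θ s)) x₂ t := by
    refine (hdr.mul hdθ.sin).congr_deriv ?_
    rw [← hvd]
    linear_combination x₂ * hsc - Real.cos (θ t) * hang
  exact hd1.prodMk hd2

/-- Planar solutions that avoid the origin, in the variables `v, θ`. -/
lemma exists_lift (H : PolarNormalForm X a a' b b' B E κ M) {γ : ℝ → ℝ × ℝ}
    (hγ : IsIntegralCurve γ fun _ => X α) (hne : ∀ t, γ t ≠ 0) :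
    ∃ v θ : ℝ → ℝ, (∀ t, 0 < v t) ∧ (∀ t, γ t = polarPt (1 / v t) (θ t)) ∧
      (∀ t, HasDerivAt θ (angSpeed B (θ t) (v t)) t) ∧
      ∀ t, HasDerivAt (fun s => zOf a b (θ s) (v s)) (radSpeed a E κ α (θ t) (v t)) t := by
  have hXc : Continuous fun t => X α (γ t) := (H.field_cont α).comp hγ.continuous
  have hx : ∀ t, HasDerivAt (fun s => (γ s).1) (X α (γ t)).1 t := fun t => (hγ t).fst
  have hy : ∀ t, HasDerivAt (fun s => (γ s).2) (X α (γ t)).2 t := fun t => (hγ t).snd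
  have hne' : ∀ t, (γ t).1 ^ 2 + (γ t).2 ^ 2 ≠ 0 := by
    intro t h
    refine hne t (Prod.ext ?_ ?_) <;> simp only [Prod.fst_zero, Prod.snd_zero] <;> nlinarith
  obtain ⟨ρ, θ, h1, h2, h3, h4⟩ := exists_polar_lift hx hy hXc.fst hXc.snd hne'
  have hpt : ∀ t, γ t = polarPt (1 / Real.exp (-ρ t)) (θ t) := by
    intro t
    rw [Real.exp_neg, one_div, inv_inv]
    exact Prod.ext (h1 t) (h2 t)
  refine ⟨fun t => Real.exp (-ρ t), θ, fun t => Real.exp_pos _, hpt, fun t => ?_, fun t => ?_⟩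
  all_goals
    have hsq := polarPt_sq (1 / Real.exp (-ρ t)) (θ t)
    rw [← hpt t] at hsq
    have hv0 := Real.exp_pos (-ρ t)
    have hang := H.angular α (θ t) _ hv0
    have hrad := H.radial α (θ t) _ hv0
    have hx1 : (γ t).1 = 1 / Real.exp (-ρ t) * Real.cos (θ t) := by rw [hpt t]; rfl
    have hy1 : (γ t).2 = 1 / Real.exp (-ρ t) * Real.sin (θ t) := by rw [hpt t]; rfl
    rw [← hpt t] at hang hrad
    have h3t := h3 t
    have h4t := h4 t
    rw [hsq, hx1, hy1] at h3t h4t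
    set v := Real.exp (-ρ t) with hv
    set x₁ := (X α (γ t)).1
    set x₂ := (X α (γ t)).2
    have hdθ : HasDerivAt θ (angSpeed B (θ t) v) t := by
      refine h4t.congr_deriv ?_
      field_simp at hang ⊢
      linarith
  · exact hdθ
  · have hdv : HasDerivAt (fun s => Real.exp (-ρ s))
        (-(Real.cos (θ t) * x₁ + Real.sin (θ t) * x₂) * v ^ 2) t := by
      refine h3t.neg.exp.congr_deriv ?_
      simp only [Pi.neg_apply]
      rw [← hv]
      field_simp
    have h5 := ((hdv.add ((H.a_deriv (θ t)).comp t hdθ)).pow 2).add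
      ((H.b_deriv (θ t)).comp t hdθ)
    refine HasDerivAt.congr_deriv (f := fun s => zOf a b (θ s) (Real.exp (-ρ s))) h5 ?_
    rw [← hrad]
    simp only [Pi.add_apply, Function.comp_apply, ← hv]
    ring

lemma vMin_lt_of_sq_lt (H : PolarNormalForm X a a' b b' B E κ M) {v θ : ℝ} (hv : 0 < v)
    (h : (polarPt (1 / v) θ).1 ^ 2 + (polarPt (1 / v) θ).2 ^ 2 < (1 / vMin κ M) ^ 2) :
    vMin κ M < v := by
  have hV := (H.inv_mem le_rfl).1
  rw [polarPt_sq] at h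
  have := lt_of_pow_lt_pow_left₀ 2 (by positivity) h
  exact (one_div_lt_one_div hv hV).1 this

lemma mem_closedBall (H : PolarNormalForm X a a' b b' B E κ M) {p : ℝ × ℝ}
    (h : p.1 ^ 2 + p.2 ^ 2 < (1 / vMin κ M) ^ 2) : p ∈ Metric.closedBall (0 : ℝ × ℝ) 1 := by
  have hV := (H.inv_mem le_rfl).2
  have h1 : (1 / vMin κ M) ^ 2 ≤ 1 := pow_le_one₀ hV.1 hV.2
  rw [mem_closedBall_zero_iff, Prod.norm_def, Real.norm_eq_abs, Real.norm_eq_abs]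
  refine max_le ?_ ?_ <;> rw [← sq_le_one_iff_abs_le_one] <;> nlinarith [sq_nonneg p.1, sq_nonneg p.2]

/-- A closed orbit near the origin, in the variables `v, θ`. -/
lemma closedOrbit_lift (H : PolarNormalForm X a a' b b' B E κ M) {Γ : Set (ℝ × ℝ)}
    (hΓ : IsClosedOrbit (X α) Γ) (hU : ∀ p ∈ Γ, p.1 ^ 2 + p.2 ^ 2 < (1 / vMin κ M) ^ 2) :
    ∃ v θ : ℝ → ℝ, Γ = range (fun t => polarPt (1 / v t) (θ t)) ∧ (∀ t, vMin κ M < v t) ∧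
      (∀ t, HasDerivAt θ (angSpeed B (θ t) (v t)) t) ∧
      (∀ t, HasDerivAt (fun s => zOf a b (θ s) (v s)) (radSpeed a E κ α (θ t) (v t)) t) ∧
      (∃ t, (∀ s, zOf a b (θ s) (v s) ≤ zOf a b (θ t) (v t)) ∧ radSpeed a E κ α (θ t) (v t) = 0) ∧
      ∃ t, (∀ s, zOf a b (θ t) (v t) ≤ zOf a b (θ s) (v s)) ∧ radSpeed a E κ α (θ t) (v t) = 0 := by
  obtain ⟨γ, T, hT, hγ, hper, hnc, rfl⟩ := hΓ
  have hmem : ∀ t, γ t ∈ Metric.closedBall (0 : ℝ × ℝ) 1 := fun t =>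
    H.mem_closedBall (hU _ (mem_range_self t))
  -- The origin is an equilibrium, so by uniqueness an orbit through it would be constant.
  have hne : ∀ t, γ t ≠ 0 := by
    intro t₀ h0
    obtain ⟨K, hK⟩ := H.field_lip α
    have hconst : ∀ t, HasDerivAt (fun _ : ℝ => (0 : ℝ × ℝ)) (X α 0) t := fun t => by
      rw [H.field_zero]; exact hasDerivAt_const _ _
    have := ODE_solution_unique_univ (v := fun _ => X α)
      (s := fun _ => Metric.closedBall (0 : ℝ × ℝ) 1) (t₀ := t₀) (fun _ => hK)
      (fun t => ⟨hγ t, hmem t⟩)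
      (fun t => ⟨hconst t, Metric.mem_closedBall_self zero_le_one⟩) h0
    obtain ⟨t, ht⟩ := hnc
    exact ht (by rw [this])
  obtain ⟨v, θ, hv0, hpt, hdθ, hdz⟩ := H.exists_lift hγ hne
  -- The lifted angle need not be periodic, but `a` and `b` depend on it only modulo 2π.
  have hzper : Function.Periodic (fun s => zOf a b (θ s) (v s)) T := by
    intro t
    have h1 := hper t
    rw [hpt, hpt] at h1
    have h2 : v (t + T) = v t := by
      have h3 := polarPt_sq (1 / v (t + T)) (θ (t + T))
      rw [h1, polarPt_sq] at h3
      have h4 := (pow_left_inj₀ (one_div_nonneg.2 (hv0 t).le)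
        (one_div_nonneg.2 (hv0 (t + T)).le) two_ne_zero).1 h3
      rw [one_div, one_div, inv_inj] at h4
      exact h4.symm
    rw [h2] at h1
    have hr : 1 / v t ≠ 0 := one_div_ne_zero (hv0 t).ne'
    have hc := mul_left_cancel₀ hr (congrArg Prod.fst h1)
    have hs := mul_left_cancel₀ hr (congrArg Prod.snd h1)
    simp only [zOf, h2, periodic_eq_of_cos_sin_eq H.a_per hc hs,
      periodic_eq_of_cos_sin_eq H.b_per hc hs]
  have hzc : Continuous fun s => zOf a b (θ s) (v s) :=
    continuous_iff_continuousAt.2 fun t => (hdz t).continuousAt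
  have hcomp := hzper.compact_of_continuous hT.ne' hzc
  have hnon := range_nonempty fun s => zOf a b (θ s) (v s)
  refine ⟨v, θ, by rw [← funext hpt], fun t => H.vMin_lt_of_sq_lt (hv0 t) (θ := θ t) ?_, hdθ, hdz,
    ?_, ?_⟩
  · rw [← hpt]; exact hU _ (mem_range_self t)
  · obtain ⟨_, ⟨t, rfl⟩, ht⟩ := hcomp.exists_isGreatest hnon
    refine ⟨t, fun s => ht (mem_range_self s), ?_⟩
    exact IsLocalMax.hasDerivAt_eq_zero (f := fun s => zOf a b (θ s) (v s)) 
      (Eventually.of_forall fun s => ht (mem_range_self s)) (hdz t)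
  · obtain ⟨_, ⟨t, rfl⟩, ht⟩ := hcomp.exists_isLeast hnon
    refine ⟨t, fun s => ht (mem_range_self s), ?_⟩
    exact IsLocalMin.hasDerivAt_eq_zero (f := fun s => zOf a b (θ s) (v s)) 
      (Eventually.of_forall fun s => ht (mem_range_self s)) (hdz t)

/-- Along a closed orbit `z` would attain a maximum, with zero speed there, but for `α ≤ 0` its
speed is positive. -/
theorem not_closedOrbit_of_nonpos (H : PolarNormalForm X a a' b b' B E κ M) (hα : α ≤ 0)
    {Γ : Set (ℝ × ℝ)} (hΓ : IsClosedOrbit (X α) Γ) :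
    ¬ ∀ p ∈ Γ, p.1 ^ 2 + p.2 ^ 2 < (1 / vMin κ M) ^ 2 := by
  intro hU
  obtain ⟨v, θ, -, hv, -, -, ⟨t, -, ht⟩, -⟩ := H.closedOrbit_lift hΓ hU
  exact (H.radSpeed_pos_of_nonpos (hv t).le (θ t) hα).ne' ht

section Loop

variable {ζ : ℝ → ℝ}

lemma strip_gt {z : ℝ} (hmin : zMin M (vMin κ M) < κ / (2 * α))
    (hz : z ∈ Icc (κ / (2 * α)) (2 * κ / α)) : zMin M (vMin κ M) < z := hmin.trans_le hz.1

/-- The speed of `z` vanishes at its extrema, which forces the whole orbit into the strip. There its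
distance to the periodic solution is bounded for all past times yet contracts exponentially, so it
is zero. -/
theorem closedOrbit_eq_loop (H : PolarNormalForm X a a' b b' B E κ M) (hα : 0 < α)
    (hmin : zMin M (vMin κ M) < κ / (2 * α))
    (hζ : ∀ θ, HasDerivAt ζ (polarField a b B E κ α θ (ζ θ)) θ)
    (hζm : ∀ θ, ζ θ ∈ Ioo (κ / (2 * α)) (2 * κ / α))
    {Γ : Set (ℝ × ℝ)} (hΓ : IsClosedOrbit (X α) Γ)
    (hU : ∀ p ∈ Γ, p.1 ^ 2 + p.2 ^ 2 < (1 / vMin κ M) ^ 2) : Γ = range (polarLoop a b ζ) := by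
  obtain ⟨v, θ, rfl, hv, hdθ, hdz, ⟨t₁, ht₁, ht₁'⟩, t₂, ht₂, ht₂'⟩ := H.closedOrbit_lift hΓ hU
  have S := H.contractingStrip hα hmin
  set z : ℝ → ℝ := fun s => zOf a b (θ s) (v s) with hz
  have hvz : ∀ t, vOf a b (θ t) (z t) = v t := fun t => H.vOf_zOf (hv t).le (θ t)
  have hzm : ∀ t, z t ∈ Icc (κ / (2 * α)) (2 * κ / α) := by
    intro t
    constructor
    · have h1 : κ / 2 < α * z t₂ := by
        by_contra hcon
        exact (H.radSpeed_pos (hv t₂).le (θ t₂) hα (not_lt.1 hcon)).ne' ht₂'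
      rw [div_le_iff₀ (by positivity)]
      have h2 := mul_le_mul_of_nonneg_left (ht₂ t) hα.le
      linarith
    · have h1 : α * z t₁ < 2 * κ := by
        by_contra hcon
        exact (H.radSpeed_neg (hv t₁).le (θ t₁) hα (not_lt.1 hcon)).ne ht₁'
      rw [le_div_iff₀ hα]
      have h2 := mul_le_mul_of_nonneg_left (ht₁ t) hα.le
      linarith
  have hang := fun t => H.angSpeed_mem (hv t).le (θ t)
  have hdz' : ∀ t, HasDerivAt z
      (angSpeed B (θ t) (v t) * polarField a b B E κ α (θ t) (z t)) t := by
    intro t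
    refine (hdz t).congr_deriv ?_
    rw [polarField, hvz, mul_div_cancel₀ _ (by linarith [(hang t).1])]
  have hdy : ∀ t, HasDerivAt (fun s => ζ (θ s))
      (angSpeed B (θ t) (v t) * polarField a b B E κ α (θ t) (ζ (θ t))) t := fun t =>
    ((hζ (θ t)).comp t (hdθ t)).congr_deriv (mul_comm _ _)
  have hanti := S.antitoneOn_sq_dist_mul_exp convex_univ (fun t _ => (hang t).1)
    (fun t _ => Ioo_subset_Icc_self (hζm (θ t))) (fun t _ => hzm t) (fun t _ => hdy t)
    (fun t _ => hdz' t)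
  have heq : ∀ t, ζ (θ t) = z t := by
    intro t
    set L := 2 * κ / α - κ / (2 * α) with hL
    have hbd : ∀ s, s ≤ t → (ζ (θ t) - z t) ^ 2 * Real.exp (α * t) ≤ L ^ 2 * Real.exp (α * s) := by
      intro s hs
      refine (hanti (mem_univ s) (mem_univ t) hs).trans ?_
      refine mul_le_mul_of_nonneg_right ?_ (Real.exp_pos _).le
      have h1 := hζm (θ s)
      have h2 := hzm s
      exact sq_le_sq' (by linarith [h1.1, h2.2]) (by linarith [h1.2, h2.1])
    have hlim : Tendsto (fun s => L ^ 2 * Real.exp (α * s)) atBot (𝓝 0) := by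
      have h1 : Tendsto (fun s => α * s) atBot atBot := tendsto_id.const_mul_atBot hα
      simpa using (Real.tendsto_exp_atBot.comp h1).const_mul (L ^ 2)
    have h0 : (ζ (θ t) - z t) ^ 2 * Real.exp (α * t) ≤ 0 :=
      ge_of_tendsto hlim ((eventually_le_atBot t).mono hbd)
    have h1 : (ζ (θ t) - z t) ^ 2 ≤ 0 := by
      by_contra hcon
      exact absurd h0 (not_le.2 (mul_pos (not_le.1 hcon) (Real.exp_pos _)))
    exact sub_eq_zero.1 (pow_eq_zero_iff two_ne_zero |>.1 (le_antisymm h1 (sq_nonneg _)))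
  have hfun : (fun t => polarPt (1 / v t) (θ t)) = polarLoop a b ζ ∘ θ := by
    funext t
    simp only [Function.comp_apply, polarLoop, heq, hvz]
  rw [hfun, (surjective_of_half_le_deriv hdθ fun t => (hang t).1).1.range_comp]

lemma loop_continuous (H : PolarNormalForm X a a' b b' B E κ M)
    (hmin : zMin M (vMin κ M) < κ / (2 * α)) (hζc : Continuous ζ)
    (hζm : ∀ θ, ζ θ ∈ Ioo (κ / (2 * α)) (2 * κ / α)) : Continuous (polarLoop a b ζ) := by
  have h1 := H.continuous_vOf_comp continuous_id hζc
  have h2 : ∀ θ, vOf a b θ (ζ θ) ≠ 0 := fun θ =>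
    (H.inv_mem (H.lt_vOf (strip_gt hmin (Ioo_subset_Icc_self (hζm θ))) θ).le).1.ne'
  have h3 : Continuous fun θ => 1 / vOf a b θ (ζ θ) := continuous_const.div h1 h2
  unfold polarLoop polarPt
  exact (h3.mul Real.continuous_cos).prodMk (h3.mul Real.continuous_sin)

lemma loop_periodic (H : PolarNormalForm X a a' b b' B E κ M)
    (hζp : Function.Periodic ζ (2 * Real.pi)) :
    Function.Periodic (polarLoop a b ζ) (2 * Real.pi) := by
  intro θ
  simp only [polarLoop, polarPt, vOf, hζp θ, H.a_per θ, H.b_per θ, Real.cos_add_two_pi,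
    Real.sin_add_two_pi]

/-- The solution is the loop run through at its own angular speed; one turn takes a fixed time
because that speed is 2π-periodic along the loop. -/
theorem loop_isClosedOrbit (H : PolarNormalForm X a a' b b' B E κ M)
    (hmin : zMin M (vMin κ M) < κ / (2 * α))
    (hζ : ∀ θ, HasDerivAt ζ (polarField a b B E κ α θ (ζ θ)) θ)
    (hζp : Function.Periodic ζ (2 * Real.pi))
    (hζm : ∀ θ, ζ θ ∈ Ioo (κ / (2 * α)) (2 * κ / α)) :
    IsClosedOrbit (X α) (range (polarLoop a b ζ)) := by
  have hζc : Continuous ζ := continuous_iff_continuousAt.2 fun t => (hζ t).continuousAt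
  have hgt := fun θ => strip_gt hmin (Ioo_subset_Icc_self (hζm θ))
  have hv := fun θ => H.lt_vOf (hgt θ) θ
  have hv0 := fun θ => (H.inv_mem (hv θ).le).1
  have hang := fun θ => H.angSpeed_mem (hv θ).le θ
  have hfc : Continuous fun θ => angSpeed B θ (vOf a b θ (ζ θ)) :=
    H.continuous_angSpeed_comp continuous_id (H.continuous_vOf_comp continuous_id hζc)
      fun θ => (hv0 θ).ne'
  have hfp : Function.Periodic (fun θ => angSpeed B θ (vOf a b θ (ζ θ))) (2 * Real.pi) := by
    intro θ
    simp only [angSpeed, vOf, hζp θ, H.a_per θ, H.b_per θ, H.B_per _ θ]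
  obtain ⟨θ, hθ0, hdθ, -, hsurj, hshift⟩ := exists_timeChange hfc
    (fun θ => by linarith [(hang θ).1]) (fun θ => by linarith [(hang θ).2]) 0
  obtain ⟨T, hT, hθT⟩ := hshift _ Real.two_pi_pos hfp
  refine ⟨fun t => polarLoop a b ζ (θ t), T, hT, fun t => ?_, fun t => ?_, ?_, ?_⟩
  · refine H.hasDerivAt_polarPt (z := fun s => ζ (θ s)) (hgt (θ t)) (hdθ t) ?_
    refine ((hζ (θ t)).comp t (hdθ t)).congr_deriv ?_
    rw [polarField, div_mul_cancel₀ _ (by linarith [(hang (θ t)).1])]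
  · simp only [hθT]
    exact H.loop_periodic hζp _
  -- At angles `0` and `π` the first coordinates have opposite signs, so the solution is not
  -- constant.
  · obtain ⟨t, ht⟩ := hsurj Real.pi
    refine ⟨t, fun h => ?_⟩
    have h1 := congrArg Prod.fst h
    simp only [ht, hθ0, polarLoop, polarPt, Real.cos_pi, Real.cos_zero] at h1
    have h2 := one_div_pos.2 (hv0 Real.pi)
    have h3 := one_div_pos.2 (hv0 0)
    linarith
  · exact (hsurj.range_comp _).symm

theorem loop_subset (H : PolarNormalForm X a a' b b' B E κ M)
    (hζm : ∀ θ, ζ θ ∈ Ioo (κ / (2 * α)) (2 * κ / α)) {V : ℝ} (hV : vMin κ M ≤ V)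
    (hmin : zMin M V < κ / (2 * α)) :
    ∀ p ∈ range (polarLoop a b ζ), p.1 ^ 2 + p.2 ^ 2 < (1 / V) ^ 2 := by
  rintro _ ⟨θ, rfl⟩
  have hv := H.lt_vOf (hmin.trans (hζm θ).1) θ
  have hV0 := (H.inv_mem hV).1
  rw [polarLoop, polarPt_sq]
  exact pow_lt_pow_left₀ (one_div_lt_one_div_of_lt hV0 hv)
    (one_div_nonneg.2 (hV0.trans hv).le) two_ne_zero

/-- Trajectories that start close to the loop in the variables `z, θ` spiral onto it. -/
lemma exists_attracted_trajectory (H : PolarNormalForm X a a' b b' B E κ M) (hα : 0 < α)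
    (hmin : zMin M (vMin κ M) < κ / (2 * α))
    (hζ : ∀ θ, HasDerivAt ζ (polarField a b B E κ α θ (ζ θ)) θ)
    (hζp : Function.Periodic ζ (2 * Real.pi))
    (hζm : ∀ θ, ζ θ ∈ Ioo (κ / (2 * α)) (2 * κ / α)) (θ₀ : ℝ) {z₀ : ℝ}
    (hz₀ : z₀ ∈ Icc (κ / (2 * α)) (2 * κ / α)) :
    ∃ γ : ℝ → ℝ × ℝ, γ 0 = polarPt (1 / vOf a b θ₀ z₀) θ₀ ∧
      IsIntegralCurveOn γ (fun _ => X α) (Ici 0) ∧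
      (∀ t, 0 ≤ t → ∃ q ∈ range (polarLoop a b ζ), dist (γ t) q ≤ |z₀ - ζ θ₀|) ∧
      omegaSet γ = range (polarLoop a b ζ) := by
  have hζc : Continuous ζ := continuous_iff_continuousAt.2 fun t => (hζ t).continuousAt
  have S := H.contractingStrip hα hmin
  obtain ⟨Z, hZc, hZ0, hZ⟩ := S.exists_forward_solution θ₀ hz₀
  have hgt := fun θ hθ => strip_gt hmin (hZ θ hθ).1
  have hv := fun θ hθ => H.lt_vOf (hgt θ hθ) θ
  have hmax := fun θ => le_max_right θ θ₀
  have hmc : Continuous fun θ => max θ θ₀ := continuous_id.max continuous_const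
  have hang := fun θ (hθ : θ₀ ≤ θ) => H.angSpeed_mem (hv θ hθ).le θ
  -- `Z` is controlled only for angles from `θ₀` on. Freezing the speed below `θ₀` makes it globally
  -- continuous and bounded, and the solution never visits the frozen part at nonnegative times.
  have hfc : Continuous fun θ =>
      angSpeed B (max θ θ₀) (vOf a b (max θ θ₀) (Z (max θ θ₀))) :=
    H.continuous_angSpeed_comp hmc (H.continuous_vOf_comp hmc (hZc.comp hmc))
      fun θ => (H.inv_mem (hv _ (hmax θ)).le).1.ne'
  obtain ⟨θ, hθ0, hdθ, hmono, -, -⟩ := exists_timeChange hfc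
    (fun θ => by linarith [(hang _ (hmax θ)).1]) (fun θ => by linarith [(hang _ (hmax θ)).2]) θ₀
  have hθt := (surjective_of_half_le_deriv hdθ fun t => (hang _ (hmax (θ t))).1).2
  have hθc : Continuous θ := continuous_iff_continuousAt.2 fun t => (hdθ t).continuousAt
  have hge : ∀ t, 0 ≤ t → θ₀ ≤ θ t := fun t ht => hθ0 ▸ hmono.monotone ht
  have hdθ' : ∀ t, 0 ≤ t → HasDerivAt θ (angSpeed B (θ t) (vOf a b (θ t) (Z (θ t)))) t := by
    intro t ht
    have := hdθ t
    rwa [max_eq_left (hge t ht)] at this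
  set ω : ℝ → ℝ := fun t => angSpeed B (θ t) (vOf a b (θ t) (Z (θ t))) with hω
  have hanti := S.antitoneOn_sq_dist_mul_exp (convex_Ici 0) (θ := θ) (θ' := ω)
    (y := fun t => Z (θ t)) (z := fun t => ζ (θ t))
    (fun t ht => (hang _ (hge t ht)).1) (fun t ht => (hZ _ (hge t ht)).1)
    (fun t _ => Ioo_subset_Icc_self (hζm (θ t)))
    (fun t ht => ((hZ _ (hge t ht)).2.comp t (hdθ' t ht)).congr_deriv (mul_comm _ _))
    (fun t ht => ((hζ (θ t)).comp t (hdθ' t ht)).congr_deriv (mul_comm _ _))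
  set γ : ℝ → ℝ × ℝ := fun t => polarPt (1 / vOf a b (θ t) (Z (θ t))) (θ t) with hγ
  have hdecay : ∀ t, 0 ≤ t →
      |Z (θ t) - ζ (θ t)| ≤ |z₀ - ζ θ₀| * Real.exp (-(α / 2) * t) := by
    intro t ht
    have h1 := hanti (mem_Ici.2 le_rfl) (mem_Ici.2 ht) ht
    simp only [hθ0, hZ0, mul_zero, Real.exp_zero, mul_one] at h1
    refine abs_le_of_sq_le_sq ?_ (by positivity)
    have h2 : Real.exp (α * t) * (Real.exp (-(α / 2) * t)) ^ 2 = 1 := by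
      rw [← Real.exp_nat_mul, ← Real.exp_add, ← Real.exp_zero]
      congr 1
      push_cast
      ring
    rw [mul_pow, sq_abs]
    calc (Z (θ t) - ζ (θ t)) ^ 2
        = (Z (θ t) - ζ (θ t)) ^ 2 * (Real.exp (α * t) * (Real.exp (-(α / 2) * t)) ^ 2) := by
          rw [h2, mul_one]
      _ = (Z (θ t) - ζ (θ t)) ^ 2 * Real.exp (α * t) * (Real.exp (-(α / 2) * t)) ^ 2 := by ring
      _ ≤ _ := mul_le_mul_of_nonneg_right h1 (by positivity)
  have hdist : ∀ t, 0 ≤ t → dist (γ t) (polarLoop a b ζ (θ t)) ≤ |Z (θ t) - ζ (θ t)| :=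
    fun t ht => (dist_polarPt_le _ _ _).trans (H.abs_inv_vOf_sub_le le_rfl
      (hgt _ (hge t ht)) (strip_gt hmin (Ioo_subset_Icc_self (hζm (θ t)))) (θ t))
  refine ⟨γ, by simp only [hγ, hθ0, hZ0], fun t ht => ?_, fun t ht => ?_, ?_⟩
  · have hd : HasDerivAt (fun s => Z (θ s)) (radSpeed a E κ α (θ t) (vOf a b (θ t) (Z (θ t)))) t := by
      refine ((hZ _ (hge t ht)).2.comp t (hdθ' t ht)).congr_deriv ?_
      rw [polarField, div_mul_cancel₀ _ (by linarith [(hang _ (hge t ht)).1])]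
    exact (H.hasDerivAt_polarPt (z := fun s => Z (θ s)) (hgt _ (hge t ht)) (hdθ' t ht) hd).hasDerivWithinAt
  · refine ⟨_, mem_range_self (θ t), (hdist t ht).trans ((hdecay t ht).trans ?_)⟩
    refine mul_le_of_le_one_right (abs_nonneg _) (Real.exp_le_one_iff.2 ?_)
    nlinarith
  · refine omegaSet_eq_range Real.two_pi_pos (H.loop_continuous hmin hζc hζm)
      (H.loop_periodic hζp) hθc.continuousOn hθt ?_
    have hlim : Tendsto (fun t => |z₀ - ζ θ₀| * Real.exp (-(α / 2) * t)) atTop (𝓝 0) := by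
      have h1 : Tendsto (fun t => -(α / 2) * t) atTop atBot :=
        tendsto_id.const_mul_atTop_of_neg (by linarith)
      simpa using (Real.tendsto_exp_atBot.comp h1).const_mul |z₀ - ζ θ₀|
    refine squeeze_zero' (Eventually.of_forall fun _ => dist_nonneg) ?_ hlim
    filter_upwards [eventually_ge_atTop 0] with t ht
    exact (hdist t ht).trans (hdecay t ht)

/-- The neighbourhood is cut out by `z` in the open strip and within `δ` of the loop at the same
angle. The gap in `z` never exceeds its initial value and dominates planar distance, so trajectories
stay in the `δ`-thickening. -/
theorem loop_isStableLimitCycle (H : PolarNormalForm X a a' b b' B E κ M) (hα : 0 < α)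
    (hmin : zMin M (vMin κ M) < κ / (2 * α))
    (hζ : ∀ θ, HasDerivAt ζ (polarField a b B E κ α θ (ζ θ)) θ)
    (hζp : Function.Periodic ζ (2 * Real.pi))
    (hζm : ∀ θ, ζ θ ∈ Ioo (κ / (2 * α)) (2 * κ / α)) :
    IsStableLimitCycle (X α) (range (polarLoop a b ζ)) := by
  refine ⟨H.loop_isClosedOrbit hmin hζ hζp hζm, fun V hV hΓV => ?_⟩
  have hζc : Continuous ζ := continuous_iff_continuousAt.2 fun t => (hζ t).continuousAt
  have hcomp := (H.loop_periodic hζp).compact_of_continuous Real.two_pi_pos.ne'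
    (H.loop_continuous hmin hζc hζm)
  obtain ⟨δ, hδ, hthick⟩ := hcomp.exists_thickening_subset_open hV hΓV
  set arg : ℝ × ℝ → ℝ := fun p => Complex.arg ⟨p.1, p.2⟩ with harg
  set inv : ℝ × ℝ → ℝ := fun p => 1 / √(p.1 ^ 2 + p.2 ^ 2) with hinv
  set zf : ℝ × ℝ → ℝ := fun p => zOf a b (arg p) (inv p) with hzf
  have hpos : ∀ p : ℝ × ℝ, p ≠ 0 → 0 < √(p.1 ^ 2 + p.2 ^ 2) := by
    intro p hp
    refine Real.sqrt_pos.2 (lt_of_le_of_ne (by positivity) fun h => hp ?_)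
    refine Prod.ext ?_ ?_ <;> simp only [Prod.fst_zero, Prod.snd_zero] <;> nlinarith
  have hζarg : ∀ p : ℝ × ℝ, p ≠ 0 → ContinuousAt (fun p => ζ (arg p)) p := fun p hp =>
    continuousAt_periodic_comp_arg hζc hζp hp
  have hzfc : ∀ p : ℝ × ℝ, p ≠ 0 → ContinuousAt zf p := by
    intro p hp
    have h1 : ContinuousAt (fun p => a (arg p)) p :=
      continuousAt_periodic_comp_arg H.a_cont H.a_per hp
    have h2 : ContinuousAt (fun p => b (arg p)) p :=
      continuousAt_periodic_comp_arg H.b_cont H.b_per hp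
    have h3 : ContinuousAt inv p := by
      refine continuousAt_const.div ?_ (hpos p hp).ne'
      exact Continuous.continuousAt (by fun_prop)
    exact ((h3.add h1).pow 2).add h2
  -- The origin must be removed by hand: there `inv` and `arg` take the default value `0` and the
  -- inverse radius is not continuous.
  set W : Set (ℝ × ℝ) := {p | p ≠ 0 ∧ p.1 ^ 2 + p.2 ^ 2 < (1 / vMin κ M) ^ 2 ∧
    κ / (2 * α) < zf p ∧ zf p < 2 * κ / α ∧ |zf p - ζ (arg p)| < δ} with hW
  refine ⟨W, isOpen_iff_mem_nhds.2 fun p hp => ?_, ?_, fun p hp => ?_⟩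
  · obtain ⟨h1, h2, h3, h4, h5⟩ := hp
    have hsq : ContinuousAt (fun p : ℝ × ℝ => p.1 ^ 2 + p.2 ^ 2) p :=
      Continuous.continuousAt (by fun_prop)
    filter_upwards [isOpen_ne.mem_nhds h1, hsq.eventually_lt continuousAt_const h2,
      continuousAt_const.eventually_lt (hzfc p h1) h3,
      (hzfc p h1).eventually_lt continuousAt_const h4,
      ((hzfc p h1).sub (hζarg p h1)).abs.eventually_lt continuousAt_const h5] with q q1 q2 q3 q4 q5
    exact ⟨q1, q2, q3, q4, q5⟩
  · rintro p hp
    have hsub := H.loop_subset hζm le_rfl hmin p hp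
    obtain ⟨φ, rfl⟩ := hp
    have hgt := strip_gt hmin (Ioo_subset_Icc_self (hζm φ))
    have hr := one_div_pos.2 (H.inv_mem (H.lt_vOf hgt φ).le).1
    obtain ⟨hc, hs⟩ := polarPt_arg hr φ
    have e1 : inv (polarLoop a b ζ φ) = vOf a b φ (ζ φ) := by
      simp only [hinv, polarLoop, polarPt_sq]
      rw [Real.sqrt_sq hr.le, one_div_one_div]
    have e2 : zf (polarLoop a b ζ φ) = ζ φ := by
      have ea : a (arg (polarLoop a b ζ φ)) = a φ := periodic_eq_of_cos_sin_eq H.a_per hc hs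
      have eb : b (arg (polarLoop a b ζ φ)) = b φ := periodic_eq_of_cos_sin_eq H.b_per hc hs
      simp only [hzf, e1, zOf, ea, eb]
      exact H.zOf_vOf hgt φ
    have e3 : ζ (arg (polarLoop a b ζ φ)) = ζ φ := periodic_eq_of_cos_sin_eq hζp hc hs
    refine ⟨polarPt_ne_zero hr φ, hsub, ?_, ?_, ?_⟩
    · rw [e2]; exact (hζm φ).1
    · rw [e2]; exact (hζm φ).2
    · rw [e2, e3, sub_self, abs_zero]; exact hδ
  · obtain ⟨h1, h2, h3, h4, h5⟩ := hp
    have hr := hpos p h1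
    have hv : vMin κ M < inv p := by
      refine H.vMin_lt_of_sq_lt (one_div_pos.2 hr) (θ := arg p) ?_
      simp only [hinv, one_div_one_div]
      rwa [← eq_polarPt_arg p]
    obtain ⟨γ, hγ0, hγ, hγd, hγω⟩ := H.exists_attracted_trajectory hα hmin hζ hζp hζm (arg p)
      (z₀ := zf p) ⟨h3.le, h4.le⟩
    refine ⟨γ, ?_, hγ, fun t ht => ?_, hγω⟩
    · rw [hγ0, H.vOf_zOf hv.le]
      simp only [hinv, one_div_one_div]
      exact (eq_polarPt_arg p).symm
    · obtain ⟨q, hq, hqd⟩ := hγd t ht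
      exact hthick (Metric.mem_thickening_iff.2 ⟨q, hq, hqd.trans_lt h5⟩)

end Loop

/-- Hopf bifurcation for planar families in third order polar normal form. -/
theorem uniqueStableLimitCycleBifurcates (H : PolarNormalForm X a a' b b' B E κ M) :
    UniqueStableLimitCycleBifurcates X := by
  have hV := (H.inv_mem le_rfl).1
  have hκ := H.kappa_pos
  have hM := H.one_le_M
  have hzmin : ∀ V, 0 < zMin M V := fun V => by unfold zMin; nlinarith [sq_nonneg (V + M)]
  have hbig : ∀ V α, 0 < α → α < κ / (2 * zMin M V) → zMin M V < κ / (2 * α) := by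
    intro V α hα h
    have h1 := hzmin V
    rw [lt_div_iff₀ (by positivity)] at h ⊢
    linarith
  have hex : ∀ α, ∃ Γ : Set (ℝ × ℝ), 0 < α → α < κ / (2 * zMin M (vMin κ M)) →
      IsStableLimitCycle (X α) Γ ∧
      (∀ V, vMin κ M ≤ V → zMin M V < κ / (2 * α) → ∀ p ∈ Γ, p.1 ^ 2 + p.2 ^ 2 < (1 / V) ^ 2) ∧
      ∀ Γ', IsClosedOrbit (X α) Γ' →
        (∀ p ∈ Γ', p.1 ^ 2 + p.2 ^ 2 < (1 / vMin κ M) ^ 2) → Γ' = Γ := by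
    intro α
    by_cases h : 0 < α ∧ α < κ / (2 * zMin M (vMin κ M))
    · have hmin := hbig _ _ h.1 h.2
      obtain ⟨ζ, hζ, hζp, hζm⟩ := (H.contractingStrip h.1 hmin).exists_periodic
      exact ⟨range (polarLoop a b ζ), fun _ _ => ⟨H.loop_isStableLimitCycle h.1 hmin hζ hζp hζm,
        fun V hV hm => H.loop_subset hζm hV hm,
        fun Γ' hΓ' hU => H.closedOrbit_eq_loop h.1 hmin hζ hζm hΓ' hU⟩⟩
    · exact ⟨∅, fun h1 h2 => absurd ⟨h1, h2⟩ h⟩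
  choose Γ hΓ using hex
  refine ⟨{p | p.1 ^ 2 + p.2 ^ 2 < (1 / vMin κ M) ^ 2}, ?_, κ / (2 * zMin M (vMin κ M)), ?_,
    fun α _ hα Γ' hΓ' hsub => H.not_closedOrbit_of_nonpos hα hΓ' fun p hp => by simpa using hsub hp, Γ, fun α h1 h2 => ?_, ?_⟩
  · refine (isOpen_lt (by fun_prop) continuous_const).mem_nhds ?_
    simp only [mem_ofPred_eq, Prod.fst_zero, Prod.snd_zero]
    have := one_div_pos.2 hV
    nlinarith
  · have := hzmin (vMin κ M)
    positivity
  · obtain ⟨g1, g2, g3⟩ := hΓ α h1 h2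
    exact ⟨g1, g2 _ le_rfl (hbig _ _ h1 h2), g3⟩
  · intro N hN
    obtain ⟨ε, hε, hball⟩ := Metric.mem_nhds_iff.1 hN
    -- A loop with inverse radius above `V` lies in the ball of radius `ε`, and `κ / (2 * α)`
    -- exceeds `zMin M V` for small `α`.
    set V := max (vMin κ M) (1 / ε) with hVd
    have hV0 : 0 < V := hV.trans_le (le_max_left _ _)
    have h1 := hzmin V
    have h2 := hzmin (vMin κ M)
    have hev : ∀ᶠ α in 𝓝[>] (0 : ℝ), α ∈ Ioo 0 (min (κ / (2 * zMin M V))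
        (κ / (2 * zMin M (vMin κ M)))) :=
      Ioo_mem_nhdsGT (lt_min (by positivity) (by positivity))
    filter_upwards [hev] with α hα p hp
    have hlt := (hΓ α hα.1 (hα.2.trans_le (min_le_right _ _))).2.1 V (le_max_left _ _)
      (hbig _ _ hα.1 (hα.2.trans_le (min_le_left _ _))) p hp
    have hVε : 1 / V ≤ ε := by
      rw [one_div_le hV0 hε]; exact le_max_right _ _
    have hsq : (1 / V) ^ 2 ≤ ε ^ 2 := pow_le_pow_left₀ (by positivity) hVε 2
    refine hball ?_
    rw [mem_ball_zero_iff, Prod.norm_def, Real.norm_eq_abs, Real.norm_eq_abs]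
    refine max_lt ?_ ?_ <;> refine abs_lt_of_sq_lt_sq ?_ hε.le <;>
      nlinarith [sq_nonneg p.1, sq_nonneg p.2]

end PolarNormalForm

end PlanarBifurcation

/-! ### Computation of the normal form from the quadratic and cubic Taylor coefficients. -/

section CubicNormalForm

/-- The quadratic form with coefficients `k = (k₁₁, k₀₂)`. -/
def quadForm (k : ℝ × ℝ) (c s : ℝ) : ℝ := k.1 * (c * s) + k.2 * s ^ 2

/-- The cubic form with coefficients `k = (k₂₁, k₁₂, k₀₃)`. -/
def cubicForm (k : ℝ × ℝ × ℝ) (c s : ℝ) : ℝ :=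
  k.1 * (c ^ 2 * s) + k.2.1 * (c * s ^ 2) + k.2.2 * s ^ 3

/-- The cubic coefficient of the radial speed after removal of the quadratic term. -/
def reducedCubic (k : ℝ × ℝ) (l m : ℝ × ℝ × ℝ) (c s : ℝ) : ℝ :=
  c * cubicForm l c s + s * cubicForm m c s - s * quadForm k c s * (c * quadForm k c s)

/-- The mean of `reducedCubic` over the unit circle. -/
noncomputable def focalValue (k : ℝ × ℝ) (l m : ℝ × ℝ × ℝ) : ℝ :=
  (3 * m.2.2 + l.2.1 + m.1 - k.1 * k.2) / 8

/-- A primitive of `s * quadForm k c s` along the unit circle. -/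
noncomputable def quadPrimitive (k : ℝ × ℝ) (c s : ℝ) : ℝ :=
  k.1 * (s ^ 3 / 3) + k.2 * (c ^ 3 / 3 - c)

/-- Twice a primitive of `reducedCubic` minus its mean along the unit circle. -/
noncomputable def cubicPrimitive (k : ℝ × ℝ) (l m : ℝ × ℝ × ℝ) (c s : ℝ) : ℝ :=
  2 * (-(l.1 * (c ^ 4 / 4)) - (l.2.1 + m.1) * ((c ^ 3 * s - c * s ^ 3) / 8)
    + (l.2.2 + m.2.1) * (s ^ 4 / 4) - m.2.2 * (c * s ^ 3 / 4 + 3 / 8 * (c * s))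
    - k.1 ^ 2 * (s ^ 4 / 4 - s ^ 6 / 6)
    - 2 * k.1 * k.2 * (c * s ^ 5 / 6 - c * s ^ 3 / 24 - c * s / 16) - k.2 ^ 2 * (s ^ 6 / 6))

/-- The integrand is a trigonometric form of odd degree, hence of mean zero, and so has a periodic
primitive. -/
lemma hasDerivAt_quadPrimitive (k : ℝ × ℝ) (θ : ℝ) :
    HasDerivAt (fun θ => quadPrimitive k (Real.cos θ) (Real.sin θ))
      (Real.sin θ * quadForm k (Real.cos θ) (Real.sin θ)) θ := by
  have hs := Real.hasDerivAt_sin θ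
  have hc := Real.hasDerivAt_cos θ
  have h1 := Real.sin_sq_add_cos_sq θ
  refine HasDerivAt.congr_deriv (f := fun θ => quadPrimitive k (Real.cos θ) (Real.sin θ))
    ((((hs.pow 3).div_const 3).const_mul k.1).add
      ((((hc.pow 3).div_const 3).sub hc).const_mul k.2)) ?_
  simp only [quadForm]
  push_cast
  linear_combination -k.2 * Real.sin θ * h1

/-- The monomials of nonzero mean are c²s², s⁴ and c²s⁴, with means 1/8, 3/8 and 1/16. After their
removal each monomial has a primitive polynomial in c and s, checked modulo c² + s² = 1. -/
lemma hasDerivAt_cubicPrimitive (k : ℝ × ℝ) (l m : ℝ × ℝ × ℝ) (θ : ℝ) :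
    HasDerivAt (fun θ => cubicPrimitive k l m (Real.cos θ) (Real.sin θ))
      (2 * (reducedCubic k l m (Real.cos θ) (Real.sin θ) - focalValue k l m)) θ := by
  have hs := Real.hasDerivAt_sin θ
  have hc := Real.hasDerivAt_cos θ
  have h1 := Real.sin_sq_add_cos_sq θ
  refine HasDerivAt.congr_deriv (f := fun θ => cubicPrimitive k l m (Real.cos θ) (Real.sin θ))
    ((((((((((hc.pow 4).div_const 4).const_mul l.1).neg).sub
      ((((hc.pow 3).mul hs).sub (hc.mul (hs.pow 3))).div_const 8 |>.const_mul (l.2.1 + m.1))).add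
      (((hs.pow 4).div_const 4).const_mul (l.2.2 + m.2.1))).sub
      ((((hc.mul (hs.pow 3)).div_const 4).add ((hc.mul hs).const_mul (3 / 8))).const_mul m.2.2)).sub
      ((((hs.pow 4).div_const 4).sub ((hs.pow 6).div_const 6)).const_mul (k.1 ^ 2))).sub
      (((((hc.mul (hs.pow 5)).div_const 6).sub ((hc.mul (hs.pow 3)).div_const 24)).sub
        ((hc.mul hs).div_const 16)).const_mul (2 * k.1 * k.2))).sub
      (((hs.pow 6).div_const 6).const_mul (k.2 ^ 2)) |>.const_mul 2) ?_
  simp only [reducedCubic, focalValue, cubicForm, quadForm, Pi.pow_apply]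
  push_cast
  set c := Real.cos θ
  set s := Real.sin θ
  linear_combination 2 * (-(l.2.1 + m.1) * (c ^ 2 + s ^ 2 + 1) / 8
    - m.2.2 * (3 / 4 * s ^ 2 + 3 / 8) + k.1 ^ 2 * s ^ 3 * c
    + 2 * k.1 * k.2 * (s ^ 4 / 6 + s ^ 2 / 8 + 1 / 16)) * h1

/-- The coefficient `B` of the angular speed, as a function of `(r, cos θ, sin θ)`; `p` and `q` are
the remainders of order four. -/
def angCoeff (k : ℝ × ℝ) (l m : ℝ × ℝ × ℝ) (p q : ℝ × ℝ × ℝ → ℝ) (u : ℝ × ℝ × ℝ) : ℝ :=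
  u.2.1 * quadForm k u.2.1 u.2.2 + u.1 * (u.2.1 * (cubicForm m u.2.1 u.2.2 + u.1 * q u)
    - u.2.2 * (cubicForm l u.2.1 u.2.2 + u.1 * p u))

/-- The remainder of the cubic coefficient of the radial speed. -/
def radRemainder (k : ℝ × ℝ) (l m : ℝ × ℝ × ℝ) (p q : ℝ × ℝ × ℝ → ℝ) (u : ℝ × ℝ × ℝ) : ℝ :=
  u.2.1 * p u + u.2.2 * q u - u.2.2 * quadForm k u.2.1 u.2.2 *
    (u.2.1 * (cubicForm m u.2.1 u.2.2 + u.1 * q u)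
      - u.2.2 * (cubicForm l u.2.1 u.2.2 + u.1 * p u))

/-- The coefficient `E` of the radial speed, as a function of `(r, cos θ, sin θ)`. -/
noncomputable def radCoeff (k : ℝ × ℝ) (l m : ℝ × ℝ × ℝ) (p q : ℝ × ℝ × ℝ → ℝ) (u : ℝ × ℝ × ℝ) :
    ℝ :=
  -2 * quadPrimitive k u.2.1 u.2.2 * reducedCubic k l m u.2.1 u.2.2
    - 2 * (1 + u.1 * quadPrimitive k u.2.1 u.2.2) * radRemainder k l m p q u
    + 2 * (reducedCubic k l m u.2.1 u.2.2 - focalValue k l m) * angCoeff k l m p q u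

/-- For radius at most one these points lie in the compact unit ball of the maximum norm, where a C¹
function is bounded and Lipschitz. -/
lemma exists_polar_bound {F : ℝ × ℝ × ℝ → ℝ} (hF : ContDiff ℝ 1 F) :
    ∃ M, 0 ≤ M ∧ ∀ r ∈ Icc (0 : ℝ) 1, ∀ θ, |F (r, Real.cos θ, Real.sin θ)| ≤ M ∧
      ∀ r' ∈ Icc (0 : ℝ) 1, |F (r, Real.cos θ, Real.sin θ) - F (r', Real.cos θ, Real.sin θ)|
        ≤ M * |r - r'| := by
  have hcomp := isCompact_closedBall (0 : ℝ × ℝ × ℝ) 1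
  obtain ⟨K, hK⟩ := LocallyLipschitzOn.exists_lipschitzOnWith_of_compact hcomp
    hF.locallyLipschitz.locallyLipschitzOn
  obtain ⟨L, hL⟩ := hcomp.exists_bound_of_continuousOn hF.continuous.continuousOn
  have hmem : ∀ r ∈ Icc (0 : ℝ) 1, ∀ θ,
      (r, Real.cos θ, Real.sin θ) ∈ Metric.closedBall (0 : ℝ × ℝ × ℝ) 1 := by
    intro r hr θ
    rw [mem_closedBall_zero_iff, Prod.norm_def, Prod.norm_def]
    simp only [Real.norm_eq_abs]
    exact max_le (abs_le.2 ⟨by linarith [hr.1], hr.2⟩)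
      (max_le (Real.abs_cos_le_one θ) (Real.abs_sin_le_one θ))
  refine ⟨max K L, K.2.trans (le_max_left _ _), fun r hr θ =>
    ⟨(hL _ (hmem r hr θ)).trans (le_max_right _ _), fun r' hr' => ?_⟩⟩
  have h := hK.dist_le_mul _ (hmem r hr θ) _ (hmem r' hr' θ)
  have hd : dist (r, Real.cos θ, Real.sin θ) (r', Real.cos θ, Real.sin θ) = |r - r'| := by
    rw [Prod.dist_eq]
    simp [Real.dist_eq]
  rw [hd, Real.dist_eq] at h
  exact h.trans (mul_le_mul_of_nonneg_right (le_max_left _ _) (abs_nonneg _))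

/-- A planar family `(α x - y + P, x + α y + Q)` in which `P` starts with cubic terms and `Q` with
quadratic terms, without pure powers of `x` in degrees two and three, is in polar normal form if its
focal value at `α = 0` is negative. -/
theorem polarNormalForm_of_cubic {X : ℝ → ℝ × ℝ → ℝ × ℝ} {k : ℝ × ℝ} {l m : ℝ × ℝ × ℝ}
    {p q : ℝ × ℝ × ℝ → ℝ} (hp : ContDiff ℝ 1 p) (hq : ContDiff ℝ 1 q) (hX : ∀ α, ContDiff ℝ 1 (X α))
    (hX0 : ∀ α, X α 0 = 0) (hfocal : focalValue k l m < 0)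
    (hX₁ : ∀ α r c s, (X α (r * c, r * s)).1
      = α * (r * c) - r * s + r ^ 3 * cubicForm l c s + r ^ 4 * p (r, c, s))
    (hX₂ : ∀ α r c s, (X α (r * c, r * s)).2 = r * c + α * (r * s) + r ^ 2 * quadForm k c s
      + r ^ 3 * cubicForm m c s + r ^ 4 * q (r, c, s)) :
    ∃ M, PolarNormalForm X (fun θ => quadPrimitive k (Real.cos θ) (Real.sin θ))
      (fun θ => Real.sin θ * quadForm k (Real.cos θ) (Real.sin θ))
      (fun θ => cubicPrimitive k l m (Real.cos θ) (Real.sin θ))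
      (fun θ => 2 * (reducedCubic k l m (Real.cos θ) (Real.sin θ) - focalValue k l m))
      (fun r θ => angCoeff k l m p q (r, Real.cos θ, Real.sin θ))
      (fun r θ => radCoeff k l m p q (r, Real.cos θ, Real.sin θ)) (-focalValue k l m) M := by
  have hB : ContDiff ℝ 1 (angCoeff k l m p q) := by
    unfold angCoeff quadForm cubicForm; fun_prop
  have hE : ContDiff ℝ 1 (radCoeff k l m p q) := by
    unfold radCoeff radRemainder angCoeff reducedCubic quadPrimitive quadForm cubicForm; fun_prop
  have ha : ContDiff ℝ 1 fun u : ℝ × ℝ × ℝ => quadPrimitive k u.2.1 u.2.2 := by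
    unfold quadPrimitive; fun_prop
  have hb : ContDiff ℝ 1 fun u : ℝ × ℝ × ℝ => cubicPrimitive k l m u.2.1 u.2.2 := by
    unfold cubicPrimitive; fun_prop
  obtain ⟨M₁, -, h₁⟩ := exists_polar_bound hB
  obtain ⟨M₂, -, h₂⟩ := exists_polar_bound hE
  obtain ⟨M₃, -, h₃⟩ := exists_polar_bound ha
  obtain ⟨M₄, -, h₄⟩ := exists_polar_bound hb
  have h0 : (0 : ℝ) ∈ Icc (0 : ℝ) 1 := ⟨le_rfl, zero_le_one⟩
  set M := max 1 (max (max M₁ M₂) (max M₃ M₄)) with hM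
  have m₁ : M₁ ≤ M := by simp [hM]
  have m₂ : M₂ ≤ M := by simp [hM]
  have m₃ : M₃ ≤ M := by simp [hM]
  have m₄ : M₄ ≤ M := by simp [hM]
  have hcs : Continuous fun x : ℝ × ℝ => (x.1, Real.cos x.2, Real.sin x.2) := by fun_prop
  have hang : ∀ α θ v, 0 < v → Real.cos θ * (X α (polarPt (1 / v) θ)).2
      - Real.sin θ * (X α (polarPt (1 / v) θ)).1 = 1 / v *
        angSpeed (fun r θ => angCoeff k l m p q (r, Real.cos θ, Real.sin θ)) θ v := by
    intro α θ v _
    have h1 := Real.sin_sq_add_cos_sq θ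
    simp only [polarPt, hX₁, hX₂, angSpeed, angCoeff]
    linear_combination 1 / v * h1
  refine ⟨M, ⟨⟨by linarith, le_max_left _ _, ?_, ?_, fun θ => ?_, fun θ => ?_,
    hB.continuous.comp hcs, hE.continuous.comp hcs, fun r θ => ?_, fun r θ => ?_,
    fun θ => ((h₃ 0 h0 θ).1).trans m₃, fun θ => ((h₄ 0 h0 θ).1).trans m₄,
    fun r hr θ => ((h₁ r hr θ).1).trans m₁, fun r hr θ => ((h₂ r hr θ).1).trans m₂,
    fun r hr r' hr' θ => ((h₁ r hr θ).2 r' hr').trans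
      (mul_le_mul_of_nonneg_right m₁ (abs_nonneg _)),
    fun r hr r' hr' θ => ((h₂ r hr θ).2 r' hr').trans
      (mul_le_mul_of_nonneg_right m₂ (abs_nonneg _))⟩,
    hasDerivAt_quadPrimitive k, hasDerivAt_cubicPrimitive k l m, hX0,
    fun α => (hX α).continuous, fun α => ?_, hang, fun α θ v hv => ?_⟩⟩
  · unfold quadPrimitive; fun_prop
  · unfold cubicPrimitive; fun_prop
  · simp only [Real.cos_add_two_pi, Real.sin_add_two_pi]
  · simp only [Real.cos_add_two_pi, Real.sin_add_two_pi]
  · simp only [Real.cos_add_two_pi, Real.sin_add_two_pi]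
  · simp only [Real.cos_add_two_pi, Real.sin_add_two_pi]
  · exact LocallyLipschitzOn.exists_lipschitzOnWith_of_compact (isCompact_closedBall _ _)
      (hX α).locallyLipschitz.locallyLipschitzOn
  · have h1 := Real.sin_sq_add_cos_sq θ
    simp only [polarPt, hX₁, hX₂, angSpeed, radSpeed, radCoeff]
    set c := Real.cos θ
    set s := Real.sin θ
    set P := p (1 / v, c, s) with hP
    set Q := q (1 / v, c, s) with hQ
    set A := quadPrimitive k c s
    set R := reducedCubic k l m c s with hR
    set Bv := angCoeff k l m p q (1 / v, c, s) with hBv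
    set Sv := radRemainder k l m p q (1 / v, c, s) with hSv
    set q2 := quadForm k c s with hq2
    set l3 := cubicForm l c s with hl3
    set m3 := cubicForm m c s with hm3
    obtain ⟨w, hw⟩ : ∃ w, w = 1 / v := ⟨_, rfl⟩
    have hvw : v * w = 1 := by rw [hw]; field_simp
    rw [← hw] at hP hQ hBv hSv ⊢
    have eR : R = c * l3 + s * m3 - s * q2 * (c * q2) := rfl
    have eB : Bv = c * q2 + w * (c * (m3 + w * Q) - s * (l3 + w * P)) := by rw [hBv, hP, hQ]; rfl
    have eS : Sv = c * P + s * Q - s * q2 * (c * (m3 + w * Q) - s * (l3 + w * P)) := by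
      rw [hSv, hP, hQ]; rfl
    have e1 : (c * (α * (w * c) - w * s + w ^ 3 * l3 + w ^ 4 * P)
        + s * (w * c + α * (w * s) + w ^ 2 * q2 + w ^ 3 * m3 + w ^ 4 * Q)) * v ^ 2
        = α * v + s * q2 + w * (c * l3 + s * m3) + w ^ 2 * (c * P + s * Q) := by
      have hvw2 : w ^ 2 * v ^ 2 = 1 := by rw [← mul_pow, mul_comm, hvw, one_pow]
      linear_combination (α * w * v ^ 2) * h1 + (α * v) * hvw
        + (s * q2 + w * (c * l3 + s * m3) + w ^ 2 * (c * P + s * Q)) * hvw2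
    -- The derivative of `a` cancels the term `s * q2` of order zero in v'. Its product with the
    -- perturbed angular speed supplies the correction to the cubic coefficient in `R`.
    have e2 : -(c * (α * (w * c) - w * s + w ^ 3 * l3 + w ^ 4 * P)
        + s * (w * c + α * (w * s) + w ^ 2 * q2 + w ^ 3 * m3 + w ^ 4 * Q)) * v ^ 2
        + s * q2 * (1 + w * Bv) = -(α * v) - w * (R + w * Sv) := by
      rw [neg_mul, e1, eR, eS, eB]
      ring
    rw [e2]
    -- Since `v * w = 1`, the factor `2 * v` turns `-w * R` into `-2 * R`; the derivative of `b`
    -- replaces this by its mean, leaving `2 * κ`.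
    linear_combination (-2 * (R + w * Sv)) * hvw

end CubicNormalForm

/-! ### Taylor expansion of the boundary polynomial and the bifurcation criterion for graphs. -/

section BoundaryPolynomial

variable {V : Type*} [Fintype V]

lemma boundary_empty (G : SimpleGraph V) : boundary G ∅ = ∅ := by
  simp [boundary]

lemma boundaryCoeff_zero_right (G : SimpleGraph V) (i : ℕ) :
    boundaryCoeff G i 0 = if i = 0 then 1 else 0 := by
  classical
  unfold boundaryCoeff
  split_ifs with h
  · subst h
    rw [Finset.card_eq_one]
    refine ⟨∅, ?_⟩
    ext S
    simp only [Finset.mem_filter, Finset.mem_univ, true_and, Finset.card_eq_zero,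
      Finset.mem_singleton]
    exact ⟨fun h => h.2, fun h => ⟨by rw [h, boundary_empty], h⟩⟩
  · rw [Finset.card_eq_zero, Finset.filter_eq_empty_iff]
    rintro S - ⟨h1, h2⟩
    rw [Finset.card_eq_zero.1 h2, boundary_empty, Finset.card_empty] at h1
    exact h h1.symm

/-- The terms of degree at least four of the boundary polynomial, in polar coordinates and divided by
the fourth power of the radius. -/
noncomputable def boundaryTail (G : SimpleGraph V) (u : ℝ × ℝ × ℝ) : ℝ :=
  ∑ S : Finset V, if 4 ≤ (boundary G S).card + S.card then
    u.1 ^ ((boundary G S).card + S.card - 4) * (u.2.1 ^ (boundary G S).card * u.2.2 ^ S.card) else 0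

lemma contDiff_boundaryTail (G : SimpleGraph V) : ContDiff ℝ 1 (boundaryTail G) := by
  unfold boundaryTail
  refine ContDiff.sum fun S _ => ?_
  split_ifs <;> fun_prop

lemma contDiff_boundaryPoly (G : SimpleGraph V) :
    ContDiff ℝ 1 fun p : ℝ × ℝ => boundaryPoly G p.1 p.2 := by
  unfold boundaryPoly
  fun_prop

lemma sum_monomials_of_degree (G : SimpleGraph V) (d : ℕ) (c s : ℝ) :
    (∑ S : Finset V, if (boundary G S).card + S.card = d then
      c ^ (boundary G S).card * s ^ S.card else 0)
      = ∑ x ∈ Finset.HasAntidiagonal.antidiagonal d, (boundaryCoeff G x.1 x.2 : ℝ) * (c ^ x.1 * s ^ x.2) := by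
  have h : ∀ x : ℕ × ℕ, (boundaryCoeff G x.1 x.2 : ℝ) * (c ^ x.1 * s ^ x.2)
      = ∑ S : Finset V, if ((boundary G S).card, S.card) = x then c ^ x.1 * s ^ x.2 else 0 := by
    intro x
    rw [boundaryCoeff, ← nsmul_eq_mul, ← Finset.sum_const, Finset.sum_filter]
    exact Finset.sum_congr rfl fun S _ => by simp [Prod.ext_iff]
  simp only [h]
  rw [Finset.sum_comm]
  refine Finset.sum_congr rfl fun S _ => ?_
  rw [Finset.sum_ite_eq]
  simp [Finset.HasAntidiagonal.mem_antidiagonal]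

/-- Only the empty set has size zero, so pure powers of x are absent; with no isolated vertex the
linear term in y disappears too. -/
lemma boundaryPoly_polar (G : SimpleGraph V) (h01 : boundaryCoeff G 0 1 = 0) (r c s : ℝ) :
    boundaryPoly G (r * c) (r * s) = 1
      + r ^ 2 * quadForm (boundaryCoeff G 1 1, boundaryCoeff G 0 2) c s
      + r ^ 3 * cubicForm (boundaryCoeff G 2 1, boundaryCoeff G 1 2, boundaryCoeff G 0 3) c s
      + r ^ 4 * boundaryTail G (r, c, s) := by
  have hsplit : boundaryPoly G (r * c) (r * s)
      = (∑ d ∈ Finset.range 4, r ^ d * ∑ S : Finset V, if (boundary G S).card + S.card = d then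
          c ^ (boundary G S).card * s ^ S.card else 0) + r ^ 4 * boundaryTail G (r, c, s) := by
    simp only [boundaryPoly, boundaryTail, Finset.mul_sum]
    rw [Finset.sum_comm, ← Finset.sum_add_distrib]
    refine Finset.sum_congr rfl fun S _ => ?_
    simp only [mul_ite, mul_zero]
    simp only [Finset.sum_ite_eq, mul_pow, Finset.mem_range]
    by_cases h : 4 ≤ (boundary G S).card + S.card
    · rw [if_neg (not_lt.2 h), if_pos h, zero_add, ← mul_assoc (r ^ 4), ← pow_add,
        Nat.add_sub_cancel' h, pow_add]
      ring
    · rw [if_pos (not_le.1 h), if_neg h, add_zero, pow_add]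
      ring
  rw [hsplit]
  simp only [sum_monomials_of_degree]
  have h0 := boundaryCoeff_zero_right G
  simp only [Finset.sum_range_succ, Finset.sum_range_zero, Finset.Nat.antidiagonal_succ,
    Finset.Nat.antidiagonal_zero, Finset.map_singleton, Finset.sum_cons, Finset.map_cons,
    Finset.sum_singleton, Function.Embedding.prodMap, Function.Embedding.coeFn_mk, Prod.map,
    Function.Embedding.refl_apply, h0, h01, quadForm, cubicForm]
  norm_num
  ring

variable {V₁ V₂ : Type*} [Fintype V₁] [Fintype V₂]

/-- Hopf bifurcation for the boundary system of two graphs without isolated vertices, the first of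
which contributes no quadratic terms. -/
theorem hopfSystem_bifurcates (G₁ : SimpleGraph V₁) (G₂ : SimpleGraph V₂)
    (h₁ : boundaryCoeff G₁ 0 1 = 0) (h₂ : boundaryCoeff G₂ 0 1 = 0)
    (h₁₁ : boundaryCoeff G₁ 1 1 = 0) (h₀₂ : boundaryCoeff G₁ 0 2 = 0) (hσ : sigmaB G₁ G₂ < 0) :
    UniqueStableLimitCycleBifurcates (hopfSystem G₁ G₂) := by
  -- When the quadratic coefficients of `G₁` vanish, σ_B is 12π times this focal value.
  have hfocal : focalValue (boundaryCoeff G₂ 1 1, boundaryCoeff G₂ 0 2)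
      (boundaryCoeff G₁ 2 1, boundaryCoeff G₁ 1 2, boundaryCoeff G₁ 0 3)
      (boundaryCoeff G₂ 2 1, boundaryCoeff G₂ 1 2, boundaryCoeff G₂ 0 3) < 0 := by
    unfold sigmaB at hσ
    rw [h₁₁, h₀₂] at hσ
    have := neg_of_mul_neg_right hσ (by positivity)
    unfold focalValue
    push_cast at this
    linarith
  have hp1 := boundaryPoly_polar G₁ h₁
  have hp2 := boundaryPoly_polar G₂ h₂
  obtain ⟨M, H⟩ := polarNormalForm_of_cubic (X := hopfSystem G₁ G₂) (contDiff_boundaryTail G₁)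
    (contDiff_boundaryTail G₂)
    (fun α => by
      have := contDiff_boundaryPoly G₁
      have := contDiff_boundaryPoly G₂
      unfold hopfSystem
      fun_prop)
    (fun α => by
      have e1 := hp1 0 0 0
      have e2 := hp2 0 0 0
      simp only [mul_zero] at e1 e2
      simp [hopfSystem, e1, e2])
    hfocal
    (fun α r c s => by
      simp only [hopfSystem, hp1, h₁₁, h₀₂, quadForm]
      push_cast
      ring)
    (fun α r c s => by
      simp only [hopfSystem, hp2]
      ring)
  exact H.uniqueStableLimitCycleBifurcates

end BoundaryPolynomial

/-! ### Perfect matchings. -/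

section Matching

variable {V W : Type*}

/-- The edges of `G` form a perfect matching, each vertex `v` being matched with `σ v`. -/
def MatchedBy (G : SimpleGraph V) (σ : V → V) : Prop := ∀ v w, G.Adj v w ↔ w = σ v

namespace MatchedBy

variable {G : SimpleGraph V} {σ : V → V}

lemma apply_apply (h : MatchedBy G σ) (v : V) : σ (σ v) = v :=
  ((h _ _).1 ((h _ _).2 rfl : G.Adj v (σ v)).symm).symm

lemma apply_ne (h : MatchedBy G σ) (v : V) : σ v ≠ v := ((h _ _).2 rfl : G.Adj v (σ v)).ne'

lemma sum (h : MatchedBy G σ) {H : SimpleGraph W} {τ : W → W} (h' : MatchedBy H τ) :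
    MatchedBy (G ⊕g H) (Sum.map σ τ) := by
  rintro (v | v) (w | w)
  · simpa using h v w
  · simp
  · simp
  · simpa using h' v w

end MatchedBy

lemma matchedBy_pathGraph_two : MatchedBy (SimpleGraph.pathGraph 2) Fin.rev := by
  intro v w
  rw [SimpleGraph.pathGraph_adj]
  fin_cases v <;> fin_cases w <;> simp

lemma matchedBy_copies {G : SimpleGraph V} {σ : V → V} (h : MatchedBy G σ) (k : ℕ) :
    MatchedBy (copies k G) fun x => (x.1, σ x.2) := by
  rintro ⟨i, v⟩ ⟨j, w⟩
  change i = j ∧ G.Adj v w ↔ _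
  rw [h v w, Prod.ext_iff]
  exact and_congr_left fun _ => eq_comm

/-- A star on two vertices is a single edge, so for `m = 2` the whole second graph is a perfect
matching. -/
lemma matchedBy_starGraph_two (c : Fin 2) : MatchedBy (SimpleGraph.starGraph c) Fin.rev := by
  intro v w
  rw [SimpleGraph.starGraph_adj]
  fin_cases c <;> fin_cases v <;> fin_cases w <;> simp

end Matching

/-! ### Counting small sets by boundary size in unions, complete graphs, matchings and stars. -/

section BoundaryCoefficients

variable {V W : Type*} [Fintype V] [Fintype W]

lemma mem_boundary {G : SimpleGraph V} {S : Finset V} {v : V} :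
    v ∈ boundary G S ↔ v ∉ S ∧ ∃ u ∈ S, G.Adj u v := by
  simp [boundary]

lemma mem_boundary_singleton {G : SimpleGraph V} {v w : V} :
    w ∈ boundary G {v} ↔ G.Adj v w := by
  simp only [mem_boundary, Finset.mem_singleton, exists_eq_left, and_iff_right_iff_imp]
  exact fun h => h.ne'

/-- The coefficients `B_{i,1}` count vertices of degree `i`. -/
lemma boundaryCoeff_one_right (G : SimpleGraph V) (i : ℕ) :
    boundaryCoeff G i 1 = ∑ v : V, if (boundary G {v}).card = i then 1 else 0 := by
  classical
  rw [← Finset.card_filter, boundaryCoeff]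
  symm
  refine Finset.card_bij (fun v _ => {v}) (fun v hv => ?_) (fun v _ w _ h => ?_) fun S hS => ?_
  · simp only [Finset.mem_filter, Finset.mem_univ, true_and] at hv
    simp [hv]
  · exact Finset.singleton_injective h
  · simp only [Finset.mem_filter, Finset.mem_univ, true_and] at hS
    obtain ⟨v, rfl⟩ := Finset.card_eq_one.1 hS.2
    exact ⟨v, by simpa using hS.1, rfl⟩

lemma boundary_sum (G : SimpleGraph V) (H : SimpleGraph W) (S : Finset (V ⊕ W)) :
    boundary (G ⊕g H) S = (boundary G S.toLeft).disjSum (boundary H S.toRight) := by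
  ext x
  rcases x with v | w
  · rw [Finset.inl_mem_disjSum, mem_boundary, mem_boundary, Finset.mem_toLeft]
    refine and_congr_right fun _ => ⟨?_, ?_⟩
    · rintro ⟨u | u, hu, h⟩
      · exact ⟨u, by simpa using hu, by simpa using h⟩
      · simp at h
    · rintro ⟨u, hu, h⟩
      exact ⟨.inl u, by simpa using hu, by simpa using h⟩
  · rw [Finset.inr_mem_disjSum, mem_boundary, mem_boundary, Finset.mem_toRight]
    refine and_congr_right fun _ => ⟨?_, ?_⟩
    · rintro ⟨u | u, hu, h⟩
      · simp at h
      · exact ⟨u, by simpa using hu, by simpa using h⟩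
    · rintro ⟨u, hu, h⟩
      exact ⟨.inr u, by simpa using hu, by simpa using h⟩

lemma card_boundary_sum (G : SimpleGraph V) (H : SimpleGraph W) (S : Finset (V ⊕ W)) :
    (boundary (G ⊕g H) S).card = (boundary G S.toLeft).card + (boundary H S.toRight).card := by
  rw [boundary_sum, Finset.card_disjSum]

lemma boundaryCoeff_one_right_sum (G : SimpleGraph V) (H : SimpleGraph W) (i : ℕ) :
    boundaryCoeff (G ⊕g H) i 1 = boundaryCoeff G i 1 + boundaryCoeff H i 1 := by
  classical
  simp only [boundaryCoeff_one_right, Fintype.sum_sum_type, card_boundary_sum]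
  have e1 : ∀ v : V, ({.inl v} : Finset (V ⊕ W)).toLeft = {v} ∧
      ({.inl v} : Finset (V ⊕ W)).toRight = ∅ := fun v => by
    constructor <;> ext <;> simp
  have e2 : ∀ w : W, ({.inr w} : Finset (V ⊕ W)).toLeft = ∅ ∧
      ({.inr w} : Finset (V ⊕ W)).toRight = {w} := fun w => by
    constructor <;> ext <;> simp
  simp only [e1, e2, boundary_empty, Finset.card_empty, add_zero, zero_add]

/-- A subset of one summand keeps its size and its boundary in the disjoint union. -/
lemma boundaryCoeff_le_sum_right (G : SimpleGraph V) (H : SimpleGraph W) (i j : ℕ) :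
    boundaryCoeff H i j ≤ boundaryCoeff (G ⊕g H) i j := by
  refine Finset.card_le_card_of_injOn (fun T => (∅ : Finset V).disjSum T) (fun T hT => ?_)
    fun T _ T' _ h => ?_
  · simp only [Finset.coe_filter, Finset.mem_univ, true_and, mem_ofPred_eq] at hT ⊢
    rw [card_boundary_sum, Finset.toLeft_disjSum, Finset.toRight_disjSum, boundary_empty,
      Finset.card_disjSum]
    simpa using hT
  · exact (Finset.disjSum_inj.1 h).2

section Complete

variable {n : ℕ}

/-- Every vertex outside a nonempty set is adjacent to it. Hence nonconstant monomials all have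
degree `n`. -/
lemma card_boundary_completeGraph {S : Finset (Fin n)} (hS : S.Nonempty) :
    (boundary (SimpleGraph.completeGraph (Fin n)) S).card + S.card = n := by
  have h : boundary (SimpleGraph.completeGraph (Fin n)) S = Sᶜ := by
    ext v
    rw [mem_boundary, Finset.mem_compl, and_iff_left_iff_imp]
    intro hv
    obtain ⟨u, hu⟩ := hS
    exact ⟨u, hu, fun h => hv (h ▸ hu)⟩
  rw [h, Finset.card_compl_add_card, Fintype.card_fin]

lemma boundaryCoeff_completeGraph_eq_zero {i j : ℕ} (hj : j ≠ 0) (h : i + j ≠ n) :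
    boundaryCoeff (SimpleGraph.completeGraph (Fin n)) i j = 0 := by
  rw [boundaryCoeff, Finset.card_eq_zero, Finset.filter_eq_empty_iff]
  rintro S - ⟨h1, h2⟩
  have := card_boundary_completeGraph (S := S) (Finset.card_pos.1 (by omega))
  omega

lemma boundaryCoeff_completeGraph_one_two_le :
    boundaryCoeff (SimpleGraph.completeGraph (Fin n)) 1 2 ≤ 3 := by
  by_cases hn : 1 + 2 = n
  · subst hn
    have h : boundaryCoeff (SimpleGraph.completeGraph (Fin (1 + 2))) 1 2
        ≤ (Finset.powersetCard 2 (Finset.univ : Finset (Fin (1 + 2)))).card := by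
      refine Finset.card_le_card fun S hS => ?_
      rw [Finset.mem_filter] at hS
      exact Finset.mem_powersetCard.2 ⟨Finset.subset_univ S, hS.2.2⟩
    rw [Finset.card_powersetCard, Finset.card_univ, Fintype.card_fin] at h
    exact h
  · rw [boundaryCoeff_completeGraph_eq_zero two_ne_zero hn]
    exact Nat.zero_le 3

end Complete

namespace MatchedBy

variable {G : SimpleGraph V} {σ : V → V}

lemma apply_mem_of_boundary_eq_empty (h : MatchedBy G σ) {S : Finset V}
    (hS : boundary G S = ∅) {v : V} (hv : v ∈ S) : σ v ∈ S := by
  by_contra hcon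
  have : σ v ∈ boundary G S := mem_boundary.2 ⟨hcon, v, hv, (h _ _).2 rfl⟩
  simp [hS] at this

/-- A set without boundary is stable under the fixed-point-free involution `σ`, which pairs off its
elements. -/
lemma even_card (h : MatchedBy G σ) {S : Finset V} (hS : boundary G S = ∅) : Even S.card := by
  have h1 : ∑ _v ∈ S, (1 : ZMod 2) = 0 :=
    Finset.sum_involution (fun v _ => σ v) (fun _ _ => by decide) (fun v _ _ => h.apply_ne v)
      (fun v hv => h.apply_mem_of_boundary_eq_empty hS hv) fun v _ => h.apply_apply v
  rw [Finset.sum_const, nsmul_eq_mul, mul_one] at h1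
  exact (ZMod.natCast_eq_zero_iff_even).1 h1

lemma boundaryCoeff_one_right (h : MatchedBy G σ) (i : ℕ) :
    boundaryCoeff G i 1 = if i = 1 then Fintype.card V else 0 := by
  have hb : ∀ v, (boundary G {v}).card = 1 := fun v => by
    rw [Finset.card_eq_one]
    refine ⟨σ v, ?_⟩
    ext w
    rw [mem_boundary_singleton, h v w, Finset.mem_singleton]
  rw [BoundaryHopf.boundaryCoeff_one_right]
  simp only [hb]
  split_ifs with h1 h2 h2
  · simp
  · exact absurd h1.symm h2
  · exact absurd h2.symm h1
  · simp

lemma boundaryCoeff_zero_three (h : MatchedBy G σ) : boundaryCoeff G 0 3 = 0 := by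
  rw [boundaryCoeff, Finset.card_eq_zero, Finset.filter_eq_empty_iff]
  rintro S - ⟨h1, h2⟩
  have := h.even_card (Finset.card_eq_zero.1 h1)
  rw [h2] at this
  exact absurd this (by decide)

/-- Each matched pair is a two-element set without boundary, and it arises from at most two
vertices. -/
lemma card_le_two_mul_boundaryCoeff (h : MatchedBy G σ) :
    Fintype.card V ≤ 2 * boundaryCoeff G 0 2 := by
  classical
  rw [← Finset.card_univ]
  refine Finset.card_le_mul_card_image_of_maps_to (f := fun v => ({v, σ v} : Finset V))
    (fun v _ => ?_) 2 fun S hS => ?_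
  · rw [Finset.mem_filter]
    refine ⟨Finset.mem_univ _, ?_, Finset.card_pair (h.apply_ne v).symm⟩
    rw [Finset.card_eq_zero, Finset.eq_empty_iff_forall_notMem]
    intro w hw
    obtain ⟨h1, u, hu, huw⟩ := mem_boundary.1 hw
    rw [h u w] at huw
    simp only [Finset.mem_insert, Finset.mem_singleton] at h1 hu
    rcases hu with rfl | rfl
    · exact h1 (Or.inr huw)
    · exact h1 (Or.inl (by rw [huw, h.apply_apply]))
  · rw [Finset.mem_filter] at hS
    rw [← hS.2.2]
    refine Finset.card_le_card fun v hv => ?_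
    rw [Finset.mem_filter] at hv
    rw [← hv.2]
    exact Finset.mem_insert_self _ _

end MatchedBy

section Star

variable {m : ℕ} (c : Fin m)

lemma card_boundary_starGraph_singleton (v : Fin m) :
    (boundary (SimpleGraph.starGraph c) {v}).card = if v = c then m - 1 else 1 := by
  split_ifs with h
  · subst h
    have : boundary (SimpleGraph.starGraph v) {v} = Finset.univ.erase v := by
      ext w
      rw [mem_boundary_singleton, SimpleGraph.starGraph_adj]
      simp [eq_comm]
    rw [this, Finset.card_erase_of_mem (Finset.mem_univ v), Finset.card_univ, Fintype.card_fin]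
  · rw [Finset.card_eq_one]
    refine ⟨c, ?_⟩
    ext w
    rw [mem_boundary_singleton, SimpleGraph.starGraph_adj, Finset.mem_singleton]
    constructor
    · rintro ⟨-, h1 | h1⟩
      · exact absurd h1 h
      · exact h1
    · rintro rfl
      exact ⟨h, Or.inr rfl⟩

lemma boundaryCoeff_starGraph_one_right (i : ℕ) :
    boundaryCoeff (SimpleGraph.starGraph c) i 1
      = (if m - 1 = i then 1 else 0) + (m - 1) * if 1 = i then 1 else 0 := by
  rw [boundaryCoeff_one_right, ← Finset.add_sum_erase _ _ (Finset.mem_univ c)]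
  simp only [card_boundary_starGraph_singleton c, if_true]
  congr 1
  rw [Finset.sum_congr rfl (g := fun _ => if 1 = i then 1 else 0) fun v hv => by
    rw [if_neg (Finset.ne_of_mem_erase hv)]]
  rw [Finset.sum_const, Finset.card_erase_of_mem (Finset.mem_univ c), Finset.card_univ,
    Fintype.card_fin, smul_eq_mul]

/-- A set without boundary is closed under adjacency, and from any vertex the centre and then every
other vertex is reached. -/
lemma eq_empty_or_univ_of_boundary_starGraph_eq_empty {S : Finset (Fin m)}
    (hS : boundary (SimpleGraph.starGraph c) S = ∅) : S = ∅ ∨ S = Finset.univ := by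
  have hcl : ∀ v ∈ S, ∀ w, (SimpleGraph.starGraph c).Adj v w → w ∈ S := by
    intro v hv w hvw
    by_contra hcon
    have : w ∈ boundary (SimpleGraph.starGraph c) S := mem_boundary.2 ⟨hcon, v, hv, hvw⟩
    simp [hS] at this
  rcases S.eq_empty_or_nonempty with h | ⟨v, hv⟩
  · exact Or.inl h
  · right
    have hc : c ∈ S := by
      by_cases h : c = v
      · rwa [h]
      · exact hcl v hv c (SimpleGraph.starGraph_center_adj' h)
    refine Finset.eq_univ_of_forall fun w => ?_
    by_cases h : c = w
    · rwa [← h]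
    · exact hcl c hc w (SimpleGraph.starGraph_center_adj h)

variable {H : SimpleGraph W} {σ : W → W}

/-- The part inside the matching is even, so the part inside the star is odd, hence the whole star,
which has at least three vertices and leaves no room for more. -/
lemma boundaryCoeff_star_sum_zero_three_le (hm : 3 ≤ m) (h : MatchedBy H σ) :
    boundaryCoeff (SimpleGraph.starGraph c ⊕g H) 0 3 ≤ if m = 3 then 1 else 0 := by
  have key : ∀ S : Finset (Fin m ⊕ W), (boundary (SimpleGraph.starGraph c ⊕g H) S).card = 0 →
      S.card = 3 → m = 3 ∧ S = (Finset.univ : Finset (Fin m)).disjSum ∅ := by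
    intro S h0 h3
    rw [card_boundary_sum, Nat.add_eq_zero_iff, Finset.card_eq_zero, Finset.card_eq_zero] at h0
    rw [← Finset.card_toLeft_add_card_toRight] at h3
    have hev := h.even_card h0.2
    rcases eq_empty_or_univ_of_boundary_starGraph_eq_empty c h0.1 with h1 | h1
    · rw [h1, Finset.card_empty, zero_add] at h3
      rw [h3] at hev
      exact absurd hev (by decide)
    · rw [h1, Finset.card_univ, Fintype.card_fin] at h3
      have h4 : S.toRight.card = 0 := by omega
      refine ⟨by omega, ?_⟩
      rw [Finset.eq_disjSum_iff]
      exact ⟨h1, Finset.card_eq_zero.1 h4⟩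
  split_ifs with hm3
  · refine Finset.card_le_one.2 fun S hS T hT => ?_
    rw [Finset.mem_filter] at hS hT
    rw [(key S hS.2.1 hS.2.2).2, (key T hT.2.1 hT.2.2).2]
  · rw [Nat.le_zero, boundaryCoeff, Finset.card_eq_zero, Finset.filter_eq_empty_iff]
    rintro S - ⟨h0, h3⟩
    exact hm3 (key S h0 h3).1

end Star

end BoundaryCoefficients

/-! ### The sign of σ_B for the two families. -/

/-- The boundary system of a complete graph on at least three vertices and a graph without isolated
vertices undergoes a Hopf bifurcation if `B_{1,1} * B_{0,2}` of the second graph is large. -/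
lemma sigmaB_neg_and_bifurcates {n : ℕ} (hn : 3 ≤ n) {W : Type*} [Fintype W] {G : SimpleGraph W}
    (h01 : boundaryCoeff G 0 1 = 0)
    (h : 3 * boundaryCoeff G 0 3 + boundaryCoeff G 2 1 + 3
      < boundaryCoeff G 1 1 * boundaryCoeff G 0 2) :
    sigmaB (SimpleGraph.completeGraph (Fin n)) G < 0 ∧
      UniqueStableLimitCycleBifurcates (hopfSystem (SimpleGraph.completeGraph (Fin n)) G) := by
  have h₁₁ : boundaryCoeff (SimpleGraph.completeGraph (Fin n)) 1 1 = 0 :=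
    boundaryCoeff_completeGraph_eq_zero one_ne_zero (by omega)
  have h₀₂ : boundaryCoeff (SimpleGraph.completeGraph (Fin n)) 0 2 = 0 :=
    boundaryCoeff_completeGraph_eq_zero two_ne_zero (by omega)
  have hσ : sigmaB (SimpleGraph.completeGraph (Fin n)) G < 0 := by
    have h12 : (boundaryCoeff (SimpleGraph.completeGraph (Fin n)) 1 2 : ℝ) ≤ 3 := by
      exact_mod_cast boundaryCoeff_completeGraph_one_two_le
    have h' : 3 * (boundaryCoeff G 0 3 : ℝ) + boundaryCoeff G 2 1 + 3
      < boundaryCoeff G 1 1 * boundaryCoeff G 0 2 := by exact_mod_cast h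
    unfold sigmaB
    refine mul_neg_of_pos_of_neg (by positivity) ?_
    rw [h₁₁, h₀₂]
    push_cast
    linarith
  exact ⟨hσ, hopfSystem_bifurcates _ _ (boundaryCoeff_completeGraph_eq_zero one_ne_zero (by omega))
    h01 h₁₁ h₀₂ hσ⟩

/-- Here B₀₃ = B₂₁ = 0, every vertex is a leaf, and B₁₁B₀₂ is at least 4·2 > 3. -/
lemma matchedBy_bifurcates {n : ℕ} (hn : 3 ≤ n) {W : Type*} [Fintype W] {G : SimpleGraph W}
    {σ : W → W} (h : MatchedBy G σ) (hW : 4 ≤ Fintype.card W) :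
    sigmaB (SimpleGraph.completeGraph (Fin n)) G < 0 ∧
      UniqueStableLimitCycleBifurcates (hopfSystem (SimpleGraph.completeGraph (Fin n)) G) := by
  have h2 := h.card_le_two_mul_boundaryCoeff
  refine sigmaB_neg_and_bifurcates hn (by simp [h.boundaryCoeff_one_right]) ?_
  simp only [h.boundaryCoeff_zero_three, h.boundaryCoeff_one_right]
  norm_num
  nlinarith

/-- For m = 3 the requirement is 7 < B₁₁B₀₂, met by 6·2; for m ≥ 4 it is 3 < B₁₁B₀₂, met by 5·1. The
excluded case m = 3 with a single extra edge has B₁₁B₀₂ = 4 = 3B₀₃ + B₂₁, and σ_B is not negative.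
-/
lemma star_sum_bifurcates {n m : ℕ} (hn : 3 ≤ n) (hm : 3 ≤ m) (c : Fin m) {W : Type*} [Fintype W]
    {H : SimpleGraph W} {σ : W → W} (h : MatchedBy H σ) (hW : 2 ≤ Fintype.card W)
    (hmW : 4 ≤ m ∨ 4 ≤ Fintype.card W) :
    sigmaB (SimpleGraph.completeGraph (Fin n)) (SimpleGraph.starGraph c ⊕g H) < 0 ∧
      UniqueStableLimitCycleBifurcates (hopfSystem (SimpleGraph.completeGraph (Fin n))
        (SimpleGraph.starGraph c ⊕g H)) := by
  have h02 := boundaryCoeff_le_sum_right (SimpleGraph.starGraph c) H 0 2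
  have h2 := h.card_le_two_mul_boundaryCoeff
  have h03 := boundaryCoeff_star_sum_zero_three_le c hm h
  have hone : ∀ i, boundaryCoeff (SimpleGraph.starGraph c ⊕g H) i 1
      = ((if m - 1 = i then 1 else 0) + (m - 1) * if 1 = i then 1 else 0)
        + if i = 1 then Fintype.card W else 0 := fun i => by
    rw [boundaryCoeff_one_right_sum, boundaryCoeff_starGraph_one_right c,
      h.boundaryCoeff_one_right]
  refine sigmaB_neg_and_bifurcates hn ?_ ?_
  · rw [hone, if_neg (by omega)]
    simp
  · have h21 : boundaryCoeff (SimpleGraph.starGraph c ⊕g H) 2 1 = if m = 3 then 1 else 0 := by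
      rw [hone]
      have : m - 1 = 2 ↔ m = 3 := by omega
      simp [this]
    have h11 : boundaryCoeff (SimpleGraph.starGraph c ⊕g H) 1 1 = m - 1 + Fintype.card W := by
      rw [hone, if_neg (by omega)]
      simp
    rw [h21, h11]
    split_ifs at h03 ⊢ with h3
    · have : 6 ≤ m - 1 + Fintype.card W := by omega
      have : 2 ≤ boundaryCoeff (SimpleGraph.starGraph c ⊕g H) 0 2 := by omega
      nlinarith
    · have : 5 ≤ m - 1 + Fintype.card W := by omega
      have : 1 ≤ boundaryCoeff (SimpleGraph.starGraph c ⊕g H) 0 2 := by omega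
      nlinarith

end BoundaryHopf

theorem corollary3p3 (n : ℕ) (hn : 3 ≤ n) :
    (∀ m : ℕ, (m = 2 ∨ 4 ≤ m) → ∀ c : Fin m,
      BoundaryHopf.sigmaB (SimpleGraph.completeGraph (Fin n))
          (SimpleGraph.starGraph c ⊕g SimpleGraph.pathGraph 2) < 0 ∧
      BoundaryHopf.UniqueStableLimitCycleBifurcates
        (BoundaryHopf.hopfSystem (SimpleGraph.completeGraph (Fin n))
          (SimpleGraph.starGraph c ⊕g SimpleGraph.pathGraph 2))) ∧
    (∀ m k : ℕ, 2 ≤ m → 2 ≤ k → ∀ c : Fin m,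
      BoundaryHopf.sigmaB (SimpleGraph.completeGraph (Fin n))
          (SimpleGraph.starGraph c ⊕g
            BoundaryHopf.copies k (SimpleGraph.pathGraph 2)) < 0 ∧
      BoundaryHopf.UniqueStableLimitCycleBifurcates
        (BoundaryHopf.hopfSystem (SimpleGraph.completeGraph (Fin n))
          (SimpleGraph.starGraph c ⊕g
            BoundaryHopf.copies k (SimpleGraph.pathGraph 2)))) := by
  have hP := BoundaryHopf.matchedBy_pathGraph_two
  refine ⟨fun m hm c => ?_, fun m k hm hk c => ?_⟩
  · rcases hm with rfl | hm
    · exact BoundaryHopf.matchedBy_bifurcates hn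
        ((BoundaryHopf.matchedBy_starGraph_two c).sum hP) (by simp)
    · exact BoundaryHopf.star_sum_bifurcates hn (by omega) c hP (by simp) (Or.inl hm)
  · have hC := BoundaryHopf.matchedBy_copies hP k
    rcases hm.eq_or_lt with rfl | hm
    · exact BoundaryHopf.matchedBy_bifurcates hn
        ((BoundaryHopf.matchedBy_starGraph_two c).sum hC) (by simp; omega)
    · exact BoundaryHopf.star_sum_bifurcates hn hm c hC (by simp; omega)
        (Or.inr (by simp; omega))
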